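/- Let $m=N+1\ge 2$ and $q\in\mathbb C\setminus\{0\}$, and put $$f(u,v)=\frac{qu-q^{-1}v}{u-v},\qquad g(u,v)=\frac{q-q^{-1}}{u-v},\qquad g^{(l)}(u,v)=u\,g(u,v).$$ Let $$R(u,v)=f(u,v)\sum_{i}E_{ii}\otimes E_{ii}+\sum_{i<j}\big(E_{ii}\otimes E_{jj}+E_{jj}\otimes E_{ii}\big)+\sum_{i<j}g(u,v)\big(u\,E_{ij}\otimes E_{ji}+v\,E_{ji}\otimes E_{ij}\big)$$ on $\mathbb C^m\otimes\mathbb C^m$. Consider a $U_q(\widehat{\mathfrak{gl}}_m)$ based model: a complex vector space $\mathcal H$, a monodromy matrix $T(u)=(T_{i,j}(u))_{i,j=1}^m$ of operators on $\mathcal H$ with $R(u,v)(T(u)\otimes\mathbf 1)(\mathbf 1\otimes T(v))=(\mathbf 1\otimes T(v))(T(u)\otimes\mathbf 1)R(u,v)$ for $u\ne v$, and a pseudovacuum $|0\rangle\in\mathcal H$ with $T_{i,i}(u)|0\rangle=\lambda_i(u)|0\rangle$ and $T_{i,j}(u)|0\rangle=0$ for $i>j$ (all this for $u,v$ in the set $\mathcal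 D\subseteq\mathbb C$ where $T$ is defined). Put $\alpha_i=\lambda_i/\lambda_{i+1}$. A function applied to finite sets of variables denotes the product over these sets; an empty product is $1$. Bethe vectors $\mathbb B(\bar t^1;\dots;\bar t^N)=\mathbb B(\bar t^1;\dots;\bar t^N|T)$, with finite sets $\bar t^k$ of parameters, are those of the nested algebraic Bethe ansatz: for $N=0$ the Bethe vector is $|0\rangle$, and for $N\ge1$ and $\bar t^1=\{t^1_1,\dots,t^1_r\}$ $$\mathbb B(\bar t^1;\dots;\bar t^N|T)=\sum_{k_1,\dots,k_r=2}^{m}\frac{T_{1,k_1}(t^1_1)\cdots T_{1,k_r}(t^1_r)}{\lambda_2(\bar t^1)\,f(\bar t^2,\bar t^1)}\Big[\mathbb B(\bar t^2;\dots;\bar t^N|\widetilde T)\Big]_{k_1,\dots,k_r}\qquad(\bar t^{N+1}=\emptyset),$$ where $\widetilde T(u)=D(u)\,\mathsf r_{0,r}(u,t^1_r)\cdots\mathsf r_{0,1}(u,t^1_1)$ acts on $\mathcal H\otimes(\mathbb C^{m-1})^{\otimes r}$, $D(u)=(T_{i,j}(u))_{i,j=2}^m$, $\mathsf r$ is the $R$-matrix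 above for $m-1$ (indices $2,\dots,m$), the pseudovacuum of $\widetilde T$ is $|0\rangle\otimes e_2^{\otimes r}$, and $[\,\cdot\,]_{k_1,\dots,k_r}$ is the component along $e_{k_1}\otimes\cdots\otimes e_{k_r}$. Let $z$ and the elements of $\bar t^1,\dots,\bar t^N$ be generic: they lie in $\mathcal D$, are pairwise distinct, $f(x,y)\neq0$ for any two different ones $x,y$, $\lambda_2(z)\ne0$, and $\lambda_{k+1}$ does not vanish on $\bar t^k$. Then, whatever the orderings used in the sets of parameters (in particular for every position of $z$ in $\{z,\bar t^1\}$), $$\mathbb B(\{z,\bar t^1\};\bar t^2;\dots;\bar t^N)=\sum_{j=2}^{N+1}\frac{T_{1,j}(z)}{\lambda_2(z)}\sum_{\mathrm{part}(\bar t^2,\dots,\bar t^{j-1})}\mathbb B(\bar t^1;\bar t^2_{\mathrm{II}};\dots;\bar t^{j-1}_{\mathrm{II}};\bar t^j;\dots;\bar t^N)\;\frac{\prod_{\nu=2}^{j-1}\alpha_\nu(\bar t^\nu_{\mathrm I})\,g^{(l)}(\bar t^\nu_{\mathrm I},\bar t^{\nu-1}_{\mathrm I})\,f(\bar t^\nu_{\mathrm{II}},\bar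 t^\nu_{\mathrm I})}{\prod_{\nu=1}^{j-1}f(\bar t^{\nu+1},\bar t^\nu_{\mathrm I})}.$$ Here the inner sum is over all partitions of each $\bar t^\nu$, $2\le\nu\le j-1$, into disjoint subsets $\bar t^\nu_{\mathrm I}$ and $\bar t^\nu_{\mathrm{II}}$ with $\#\bar t^\nu_{\mathrm I}=1$ (there is none if one of these sets is empty), and $\bar t^1_{\mathrm I}=\{z\}$, $\bar t^{N+1}=\emptyset$. -/

import Mathlib

open scoped Kronecker

universe u

namespace UqBethe

/-- `f(u,v) = (q u - q⁻¹ v) / (u - v)`. -/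
noncomputable def f (q u v : ℂ) : ℂ := (q * u - q⁻¹ * v) / (u - v)

/-- `g(u,v) = (q - q⁻¹) / (u - v)`. -/
noncomputable def g (q u v : ℂ) : ℂ := (q - q⁻¹) / (u - v)

/-- `g^{(l)}(u,v) = u g(u,v)`. -/
noncomputable def gl (q u v : ℂ) : ℂ := u * g q u v

/-- `f(ū, v̄)`, the double product over two families of variables (`1` if one is empty). -/
noncomputable def fProd (q : ℂ) (us vs : List ℂ) : ℂ :=
  (us.map fun u => (vs.map fun v => f q u v).prod).prod

/-- The `R`-matrix of the vector representation on `ℂ^m ⊗ ℂ^m`, in the basis indexed by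
`Fin m × Fin m`. -/
noncomputable def RMatrix (q : ℂ) (m : ℕ) (u v : ℂ) :
    Matrix (Fin m × Fin m) (Fin m × Fin m) ℂ :=
  f q u v • ∑ i : Fin m, Matrix.single i i (1 : ℂ) ⊗ₖ Matrix.single i i (1 : ℂ)
    + ∑ i : Fin m, ∑ j ∈ Finset.Ioi i,
        (Matrix.single i i (1 : ℂ) ⊗ₖ Matrix.single j j (1 : ℂ)
          + Matrix.single j j (1 : ℂ) ⊗ₖ Matrix.single i i (1 : ℂ))
    + ∑ i : Fin m, ∑ j ∈ Finset.Ioi i,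
        g q u v • (u • (Matrix.single i j (1 : ℂ) ⊗ₖ Matrix.single j i (1 : ℂ))
          + v • (Matrix.single j i (1 : ℂ) ⊗ₖ Matrix.single i j (1 : ℂ)))

section Model

variable {H : Type u} [AddCommGroup H] [Module ℂ H] {m : ℕ}

/-- `X ⊗ 1`, for a matrix `X` with operator entries. -/
def onFirst (X : Matrix (Fin m) (Fin m) (Module.End ℂ H)) :
    Matrix (Fin m × Fin m) (Fin m × Fin m) (Module.End ℂ H) :=
  Matrix.of fun a b => if a.2 = b.2 then X a.1 b.1 else 0

/-- `1 ⊗ X`, for a matrix `X` with operator entries. -/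
def onSecond (X : Matrix (Fin m) (Fin m) (Module.End ℂ H)) :
    Matrix (Fin m × Fin m) (Fin m × Fin m) (Module.End ℂ H) :=
  Matrix.of fun a b => if a.1 = b.1 then X a.2 b.2 else 0

/-- `T` is the monodromy matrix of a (generalized) `U_q(gl_m^)` based model on the space `H`,
with pseudovacuum `vac` and vacuum eigenvalues `lam`. The set `D` consists of the values of the
spectral parameter at which `T` is defined (for instance, not a pole of `T`). -/
structure IsModel (q : ℂ) (D : Set ℂ) (T : ℂ → Matrix (Fin m) (Fin m) (Module.End ℂ H))
    (lam : Fin m → ℂ → ℂ) (vac : H) : Prop where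
  rtt : ∀ u ∈ D, ∀ v ∈ D, u ≠ v →
    (RMatrix q m u v).map (algebraMap ℂ (Module.End ℂ H)) * onFirst (T u) * onSecond (T v)
      = onSecond (T v) * onFirst (T u) * (RMatrix q m u v).map (algebraMap ℂ (Module.End ℂ H))
  diag : ∀ u ∈ D, ∀ i : Fin m, T u i i vac = lam i u • vac
  lower : ∀ u ∈ D, ∀ i j : Fin m, j < i → T u i j vac = 0

end Model

section Nested

variable {H : Type u} [AddCommGroup H] [Module ℂ H]

/- The space `H ⊗ (ℂ^n)^{⊗ r}` is `(Fin r → Fin n) → H`: a vector is the family of its components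
`[w]_{k_1,…,k_r} ∈ H` in the standard basis of `(ℂ^n)^{⊗ r}`. -/

/-- The `(a,b)` entry (with respect to the auxiliary space) of the `R`-matrix `R_{0,s}(u,ξ)` which
acts in the auxiliary space `ℂ^n` and in the `s`-th tensor factor. -/
noncomputable def siteOp (q : ℂ) {n r : ℕ} (u ξ : ℂ) (s : Fin r) (a b : Fin n) :
    Module.End ℂ ((Fin r → Fin n) → H) where
  toFun w := fun K => ∑ d : Fin n, RMatrix q n u ξ (a, K s) (b, d) • w (Function.update K s d)
  map_add' w w' := by
    funext K
    simp [Finset.sum_add_distrib]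
  map_smul' c w := by
    funext K
    simp [Finset.smul_sum, smul_comm c]

/-- `R_{0,r}(u,t_r) ⋯ R_{0,1}(u,t_1)`, as a matrix in the auxiliary space. -/
noncomputable def inhomMonodromy (q : ℂ) (n : ℕ) (ts : List ℂ) (u : ℂ) :
    Matrix (Fin n) (Fin n) (Module.End ℂ ((Fin ts.length → Fin n) → H)) :=
  (List.ofFn fun s : Fin ts.length =>
    (Matrix.of fun a b => siteOp q u (ts.get s) s a b :
      Matrix (Fin n) (Fin n) (Module.End ℂ ((Fin ts.length → Fin n) → H)))).reverse.prod

/-- The nested monodromy matrix `D(u) R_{0,r}(u,t_r) ⋯ R_{0,1}(u,t_1)`, where `D` is the lower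
right block of `T`, obtained by deleting the first row and the first column. -/
noncomputable def nestedMonodromy (q : ℂ) {n : ℕ}
    (T : ℂ → Matrix (Fin (n + 1)) (Fin (n + 1)) (Module.End ℂ H)) (ts : List ℂ) (u : ℂ) :
    Matrix (Fin n) (Fin n) (Module.End ℂ ((Fin ts.length → Fin n) → H)) :=
  (Matrix.of fun a b => (T u a.succ b.succ).compLeft (Fin ts.length → Fin n))
    * inhomMonodromy q n ts u

/-- The nested pseudovacuum `|0⟩ ⊗ e_1 ⊗ ⋯ ⊗ e_1`, where `e_1` is the first basis vector of
`ℂ^{n+1}`. -/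
def nestedVacuum (n : ℕ) (vac : H) (ts : List ℂ) : (Fin ts.length → Fin (n + 1)) → H :=
  fun K => if ∀ s, K s = 0 then vac else 0

/-- The vacuum eigenvalues of the nested monodromy matrix: the first one is
`λ_2(u) f(u, t̄)`, the other ones are `λ_3(u), λ_4(u), …`. -/
noncomputable def nestedLam (q : ℂ) {n : ℕ} (lam : Fin (n + 2) → ℂ → ℂ) (ts : List ℂ) :
    Fin (n + 1) → ℂ → ℂ :=
  Fin.cons (fun u => lam 1 u * fProd q [u] ts) fun i => lam i.succ.succ

end Nested

/-- The set of parameters of the color with (zero-based) number `k`; it is empty beyond the last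
color. -/
def colorSet {N : ℕ} (t : Fin N → List ℂ) (k : ℕ) : List ℂ :=
  if h : k < N then t ⟨k, h⟩ else []

/-- The Bethe vector `𝔹(t̄^1; …; t̄^N)` of a model of rank `m = N + 1`, given by the nested
algebraic Bethe ansatz:
`𝔹(t̄ | T) = ∑_{k_1,…,k_r} T_{1,k_1}(t^1_1) ⋯ T_{1,k_r}(t^1_r) [𝔹(t̄^2; …; t̄^N | T̃)]_{k_1,…,k_r}
  / (λ_2(t̄^1) f(t̄^2, t̄^1))`,
where `T̃` is the nested monodromy matrix; for `N = 0` it is the pseudovacuum. The color `k` is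
numbered by `k - 1 : Fin N`, the matrix index `i` by `i - 1 : Fin (N + 1)`. -/
noncomputable def betheVector (q : ℂ) : (N : ℕ) → {H : Type u} → [AddCommGroup H] → [Module ℂ H] →
    (T : ℂ → Matrix (Fin (N + 1)) (Fin (N + 1)) (Module.End ℂ H)) →
    (lam : Fin (N + 1) → ℂ → ℂ) → (vac : H) → (t : Fin N → List ℂ) → H
  | 0, _, _, _, _, _, vac, _ => vac
  | N + 1, _, _, _, T, lam, vac, t =>
      (((t 0).map (lam 1)).prod * fProd q (colorSet t 1) (t 0))⁻¹ •
        ∑ K : Fin (t 0).length → Fin (N + 1),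
          (List.ofFn fun s => T ((t 0).get s) 0 (K s).succ).prod
            (betheVector q N (nestedMonodromy q T (t 0)) (nestedLam q lam (t 0))
              (nestedVacuum N vac (t 0)) (fun k => t k.succ) K)

/-- The ratio `α_k = λ_k / λ_{k+1}`. -/
noncomputable def alpha {N : ℕ} (lam : Fin (N + 1) → ℂ → ℂ) (k : Fin N) (u : ℂ) : ℂ :=
  lam k.castSucc u / lam k.succ u

/-- The parameters in the list are generic: pairwise distinct, and no `f(x,y)` with different
`x`, `y` vanishes. -/
def Generic (q : ℂ) (ts : List ℂ) : Prop :=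
  ts.Nodup ∧ ∀ x ∈ ts, ∀ y ∈ ts, x ≠ y → f q x y ≠ 0

section Partitions

variable {n : ℕ}

/-- The color which follows the first `ν + 1` colors, where `ν < j ≤ n`. -/
def color (j : Fin (n + 1)) (ν : Fin j.val) : Fin (n + 1) := ⟨ν.val + 1, by omega⟩

/-- The partitions of the sets of colors with zero-based numbers `1, …, j` into a one-element
subset and its complement: a position in each of these sets. There is none if one of the sets is
empty. -/
abbrev Partition (t : Fin (n + 1) → List ℂ) (j : Fin (n + 1)) : Type :=
  (ν : Fin j.val) → Fin (t (color j ν)).length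

/-- The elements of the one-element subsets; the one of the first color is `z`. -/
def partI (z : ℂ) (t : Fin (n + 1) → List ℂ) (j : Fin (n + 1)) (p : Partition t j) :
    Fin (j.val + 1) → ℂ :=
  Fin.cons z fun ν => (t (color j ν)).get (p ν)

/-- The complementary subsets for the colors `1, …, j`, and the full sets for the other colors. -/
def partII (t : Fin (n + 1) → List ℂ) (j : Fin (n + 1)) (p : Partition t j) :
    Fin (n + 1) → List ℂ := fun k =>
  if h : 1 ≤ k.val ∧ k.val ≤ j.val then (t k).eraseIdx (p ⟨k.val - 1, by omega⟩).val else t k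

/-- The coefficient
`∏_{ν=2}^{j-1} α_ν(t_I^ν) g^{(l)}(t_I^ν, t_I^{ν-1}) f(t_II^ν, t_I^ν) / ∏_{ν=1}^{j-1} f(t^{ν+1}, t_I^ν)`,
where the `j` in this formula is `j + 2` for the zero-based `j` below. -/
noncomputable def recCoeff (q : ℂ) (lam : Fin (n + 2) → ℂ → ℂ) (z : ℂ)
    (t : Fin (n + 1) → List ℂ) (j : Fin (n + 1)) (p : Partition t j) : ℂ :=
  (∏ ν : Fin j.val,
      alpha lam (color j ν) (partI z t j p ν.succ)
        * gl q (partI z t j p ν.succ) (partI z t j p ν.castSucc)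
        * fProd q (partII t j p (color j ν)) [partI z t j p ν.succ])
    / ∏ ν : Fin (j.val + 1), fProd q (colorSet t (ν.val + 1)) [partI z t j p ν]

end Partitions

end UqBethe

/-! The order of `{z, t̄¹}` does not matter: reordering acts by the same R-matrix on the products of
creation operators and on the components of the nested Bethe vector, and the two actions cancel
(`creationSum_perm`). With `z` in front, the ansatz is a sum over `j` of `T_{1,j}(z)` applied to a
creation sum over `t̄¹`, taken of the components of the nested vector with first tensor index `j`.
The nested monodromy matrix is the one for `t̄¹` alone times one more factor `R_{0,1}(u,z)`. It
therefore suffices to express the components, along the extra site, of the Bethe vectors of `T(u)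
R_{0,1}(u,z)` through Bethe vectors of `T(u)` (`betheVector_siteExt`).

This goes by induction on the rank. The nested vectors of the extended model are `w ⊗ e_1`, with `w`
nested for `T` (`nestedBethe_siteExt`), so the `e_1` component is the Bethe vector of `T` itself.
For `e_k` with `k ≥ 2`, one parameter `y` of the first set leaves the product of creation operators:
it contributes `λ_1(y) g^{(l)}(y,z) f(t̄_II,y)` and becomes the first inhomogeneity of the nested
vector (`creationSum_siteExt_succ`). What remains is again a component along an extra site, in a
model of rank one less with `y` in the role of `z`. The colors are thus treated one at a time, and
the normalizations turn `λ_1(y)` into `α_1(y)`. Finally `sum_partition` identifies the iterated sum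
with the sum over partitions.

Bethe vectors of different models are compared by one principle, `betheVector_rel`: a linear
relation respected by the monodromy entries and by the vacua is inherited by the Bethe vectors. -/

namespace UqBethe

/-! ### The R-matrix in components, the RTT relation and the Yang–Baxter equation -/

/-- The coefficient of the identity in the action of the `R`-matrix on `e_a ⊗ e_k`. -/
noncomputable def rA (q : ℂ) {n : ℕ} (u v : ℂ) (a k : Fin n) : ℂ := if a = k then f q u v else 1

/-- The coefficient of the permutation in the action of the `R`-matrix. -/
noncomputable def rB (q : ℂ) {n : ℕ} (u v : ℂ) (a k : Fin n) : ℂ :=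
  if a < k then g q u v * u else if k < a then g q u v * v else 0

/-- On each pair of basis vectors the R-matrix is a multiple of the identity plus a multiple of the
flip; all later computations use only these two coefficients. -/
lemma RMatrix_apply (q : ℂ) {n : ℕ} (u v : ℂ) (a k b d : Fin n) :
    RMatrix q n u v (a, k) (b, d) = (if a = b ∧ k = d then rA q u v a k else 0)
      + if a = d ∧ k = b then rB q u v a k else 0 := by
  have h1 : (∑ i : Fin n, Matrix.single i i (1 : ℂ) ⊗ₖ Matrix.single i i (1 : ℂ)) (a, k) (b, d)
      = if a = b ∧ k = d ∧ a = k then 1 else 0 := by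
    simp only [Matrix.sum_apply, Matrix.kroneckerMap_apply, Matrix.single_apply, mul_ite, mul_one,
      mul_zero, ← ite_and]
    rw [Finset.sum_eq_single a]
    · grind
    · grind
    · simp
  have key : ∀ (p : Prop) [Decidable p] (i₀ j₀ : Fin n) (x : ℂ),
      ∑ i : Fin n, ∑ j ∈ Finset.Ioi i, (if i = i₀ ∧ j = j₀ ∧ p then x else 0)
        = if i₀ < j₀ ∧ p then x else 0 := by
    intro p _ i₀ j₀ x
    rw [Finset.sum_eq_single i₀]
    · by_cases h : i₀ < j₀ ∧ p
      · rw [Finset.sum_eq_single j₀] <;> simp +contextual [h]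
      · rw [Finset.sum_eq_zero, if_neg h]
        intro j hj
        rw [if_neg]
        rintro ⟨-, rfl, hp⟩
        exact h ⟨Finset.mem_Ioi.1 hj, hp⟩
    · intro i _ hi
      simp [hi]
    · simp
  have h2 : ∀ x y : ℂ, (∑ i : Fin n, ∑ j ∈ Finset.Ioi i,
      (x • (Matrix.single i i (1 : ℂ) ⊗ₖ Matrix.single j j (1 : ℂ))
        + y • (Matrix.single j j (1 : ℂ) ⊗ₖ Matrix.single i i (1 : ℂ)))) (a, k) (b, d)
      = if a = b ∧ k = d then (if a < k then x else if k < a then y else 0) else 0 := by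
    intro x y
    have e : ∀ i j : Fin n, (x • (Matrix.single i i (1 : ℂ) ⊗ₖ Matrix.single j j (1 : ℂ))
        + y • (Matrix.single j j (1 : ℂ) ⊗ₖ Matrix.single i i (1 : ℂ))) (a, k) (b, d)
        = (if i = a ∧ j = k ∧ a = b ∧ k = d then x else 0)
          + if i = k ∧ j = a ∧ a = b ∧ k = d then y else 0 := by
      intro i j
      simp only [Matrix.add_apply, Matrix.smul_apply, Matrix.kroneckerMap_apply,
        Matrix.single_apply, smul_eq_mul]
      grind
    simp only [Matrix.sum_apply, e]
    simp only [Finset.sum_add_distrib, key]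
    grind
  have h3 : ∀ x y : ℂ, (∑ i : Fin n, ∑ j ∈ Finset.Ioi i,
      (x • (Matrix.single i j (1 : ℂ) ⊗ₖ Matrix.single j i (1 : ℂ))
        + y • (Matrix.single j i (1 : ℂ) ⊗ₖ Matrix.single i j (1 : ℂ)))) (a, k) (b, d)
      = if a = d ∧ k = b then (if a < k then x else if k < a then y else 0) else 0 := by
    intro x y
    have e : ∀ i j : Fin n, (x • (Matrix.single i j (1 : ℂ) ⊗ₖ Matrix.single j i (1 : ℂ))
        + y • (Matrix.single j i (1 : ℂ) ⊗ₖ Matrix.single i j (1 : ℂ))) (a, k) (b, d)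
        = (if i = a ∧ j = k ∧ a = d ∧ k = b then x else 0)
          + if i = k ∧ j = a ∧ a = d ∧ k = b then y else 0 := by
      intro i j
      simp only [Matrix.add_apply, Matrix.smul_apply, Matrix.kroneckerMap_apply,
        Matrix.single_apply, smul_eq_mul]
      grind
    simp only [Matrix.sum_apply, e]
    simp only [Finset.sum_add_distrib, key]
    grind
  have h2' := h2 1 1
  have h3' := h3 (g q u v * u) (g q u v * v)
  simp only [one_smul] at h2'
  simp only [mul_smul, ← smul_add] at h3'
  rw [RMatrix, Matrix.add_apply, Matrix.add_apply, Matrix.smul_apply, h1, h2', h3']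
  simp only [rA, rB, smul_eq_mul]
  grind

section
variable {H : Type u} [AddCommGroup H] [Module ℂ H] {n : ℕ}

/-- The componentwise form of the `RTT` relation. -/
def Exchange (q u v : ℂ) (X Y : Matrix (Fin n) (Fin n) (Module.End ℂ H)) : Prop :=
  ∀ (a a' b b' : Fin n) (w : H),
    rA q u v a a' • X a b (Y a' b' w) + rB q u v a a' • X a' b (Y a b' w)
      = rA q u v b b' • Y a' b' (X a b w) + rB q u v b' b • Y a' b (X a b' w)

lemma onFirst_mul_onSecond (X Y : Matrix (Fin n) (Fin n) (Module.End ℂ H)) (a a' b b' : Fin n) :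
    (onFirst X * onSecond Y) (a, a') (b, b') = X a b * Y a' b' := by
  simp [Matrix.mul_apply, onFirst, onSecond, Fintype.sum_prod_type]

lemma onSecond_mul_onFirst (X Y : Matrix (Fin n) (Fin n) (Module.End ℂ H)) (a a' b b' : Fin n) :
    (onSecond Y * onFirst X) (a, a') (b, b') = Y a' b' * X a b := by
  simp [Matrix.mul_apply, onFirst, onSecond, Fintype.sum_prod_type]

lemma rtt_iff_exchange (q u v : ℂ) (X Y : Matrix (Fin n) (Fin n) (Module.End ℂ H)) :
    (RMatrix q n u v).map (algebraMap ℂ (Module.End ℂ H)) * onFirst X * onSecond Y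
      = onSecond Y * onFirst X * (RMatrix q n u v).map (algebraMap ℂ (Module.End ℂ H))
      ↔ Exchange q u v X Y := by
  have hl : ∀ a a' b b' w, ((RMatrix q n u v).map (algebraMap ℂ (Module.End ℂ H)) *
      (onFirst X * onSecond Y)) (a, a') (b, b') w
      = rA q u v a a' • X a b (Y a' b' w) + rB q u v a a' • X a' b (Y a b' w) := by
    intro a a' b b' w
    rw [Matrix.mul_apply, Fintype.sum_prod_type]
    simp only [onFirst_mul_onSecond, Matrix.map_apply, RMatrix_apply, map_add, add_mul,
      Finset.sum_add_distrib, LinearMap.add_apply]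
    congr 1
    · rw [Finset.sum_eq_single a, Finset.sum_eq_single a'] <;> simp +contextual [Ne.symm, eq_comm]
    · rw [Finset.sum_eq_single a', Finset.sum_eq_single a] <;> simp +contextual [Ne.symm, eq_comm]
  have hr : ∀ a a' b b' w, (onSecond Y * onFirst X *
      (RMatrix q n u v).map (algebraMap ℂ (Module.End ℂ H))) (a, a') (b, b') w
      = rA q u v b b' • Y a' b' (X a b w) + rB q u v b' b • Y a' b (X a b' w) := by
    intro a a' b b' w
    rw [Matrix.mul_apply, Fintype.sum_prod_type]
    simp only [onSecond_mul_onFirst, Matrix.map_apply, RMatrix_apply, map_add, mul_add,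
      Finset.sum_add_distrib, LinearMap.add_apply]
    congr 1
    · rw [Finset.sum_eq_single b, Finset.sum_eq_single b'] <;> simp +contextual [Ne.symm, eq_comm]
    · rw [Finset.sum_eq_single b', Finset.sum_eq_single b] <;> simp +contextual [Ne.symm, eq_comm]
  rw [mul_assoc]
  constructor
  · intro h a a' b b' w
    rw [← hl, ← hr, h]
  · intro h
    ext ⟨a, a'⟩ ⟨b, b'⟩ w
    rw [hl, hr, h]

lemma IsModel.exchange {q : ℂ} {D : Set ℂ} {T : ℂ → Matrix (Fin n) (Fin n) (Module.End ℂ H)}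
    {lam : Fin n → ℂ → ℂ} {vac : H} (hT : IsModel q D T lam vac) {u v : ℂ} (hu : u ∈ D)
    (hv : v ∈ D) (huv : u ≠ v) : Exchange q u v (T u) (T v) :=
  (rtt_iff_exchange q u v _ _).1 (hT.rtt u hu v hv huv)

/-- The Yang–Baxter equation. -/
lemma yangBaxter (q : ℂ) {u v z : ℂ} (huv : u ≠ v) (huz : u ≠ z) (hvz : v ≠ z)
    (F : Fin n → Fin n → Fin n → H) (a b c : Fin n) :
    rA q u v a b • (rA q u z a c • (rA q v z b c • F a b c + rB q v z b c • F a c b)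
        + rB q u z a c • (rA q v z b a • F c b a + rB q v z b a • F c a b))
      + rB q u v a b • (rA q u z b c • (rA q v z a c • F b a c + rB q v z a c • F b c a)
        + rB q u z b c • (rA q v z a b • F c a b + rB q v z a b • F c b a))
    = rA q v z b c • (rA q u z a c • (rA q u v a b • F a b c + rB q u v a b • F b a c)
        + rB q u z a c • (rA q u v c b • F c b a + rB q u v c b • F b c a))
      + rB q v z b c • (rA q u z a b • (rA q u v a c • F a c b + rB q u v a c • F c a b)
        + rB q u z a b • (rA q u v b c • F b c a + rB q u v b c • F c b a)) := by
  have h1 := sub_ne_zero.2 huv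
  have h2 := sub_ne_zero.2 huz
  have h3 := sub_ne_zero.2 hvz
  rcases lt_trichotomy a b with hab | hab | hab <;>
  rcases lt_trichotomy b c with hbc | hbc | hbc <;>
  rcases lt_trichotomy a c with hac | hac | hac <;>
  -- Contradictory order patterns are discarded; in each consistent one, comparing the coefficients
  -- of the permuted values of `F` leaves rational identities in the spectral parameters.
  first
  | (exfalso; omega)
  | (try subst hab
     try subst hbc
     try subst hac
     simp only [rA, rB, lt_self_iff_false, if_false, if_true, *, not_lt_of_gt, ne_of_gt, ne_of_lt,
       zero_smul, add_zero, f, g]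
     match_scalars <;> field_simp <;> ring)

end

/-! ### Models with additional inhomogeneous sites -/

section
variable {H : Type u} [AddCommGroup H] [Module ℂ H] {n : ℕ}

/-- The `R`-matrix acting in the auxiliary space and in one copy of `ℂ^n`. -/
noncomputable def siteR (q z u : ℂ) : Matrix (Fin n) (Fin n) (Module.End ℂ (Fin n → H)) :=
  Matrix.of fun a b =>
    { toFun := fun w k => (if a = b then rA q u z a k • w k else 0)
        + if k = b then rB q u z a k • w a else 0
      map_add' := fun w w' => by ext k; simp only [Pi.add_apply]; split_ifs <;> module
      map_smul' := fun c w => by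
        ext k; simp only [Pi.smul_apply, RingHom.id_apply]; split_ifs <;> module }

/-- The monodromy matrix `T(u) R_{0,1}(u,z)` on `H ⊗ ℂ^n`. -/
noncomputable def siteExt (q : ℂ) (T : ℂ → Matrix (Fin n) (Fin n) (Module.End ℂ H)) (z u : ℂ) :
    Matrix (Fin n) (Fin n) (Module.End ℂ (Fin n → H)) :=
  (Matrix.of fun a b => (T u a b).compLeft (Fin n)) * siteR q z u

lemma siteR_apply (q z u : ℂ) (a b : Fin n) (w : Fin n → H) (k : Fin n) :
    siteR q z u a b w k = (if a = b then rA q u z a k • w k else 0)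
      + if k = b then rB q u z a k • w a else 0 := rfl

lemma siteExt_apply (q : ℂ) (T : ℂ → Matrix (Fin n) (Fin n) (Module.End ℂ H)) (z u : ℂ)
    (a b : Fin n) (w : Fin n → H) (k : Fin n) :
    siteExt q T z u a b w k = rA q u z b k • T u a b (w k)
      + if k = b then ∑ c, rB q u z c b • T u a c (w c) else 0 := by
  simp only [siteExt, Matrix.mul_apply, LinearMap.sum_apply, Finset.sum_apply, Matrix.of_apply,
    Module.End.mul_apply, LinearMap.compLeft_apply, Function.comp_apply, siteR_apply, map_add,
    Finset.sum_add_distrib]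
  congr 1
  · rw [Finset.sum_eq_single b] <;> simp +contextual
  · by_cases h : k = b <;> simp [h]

lemma exchange_siteR (q : ℂ) {u v z : ℂ} (huv : u ≠ v) (huz : u ≠ z) (hvz : v ≠ z) :
    Exchange q u v (siteR (H := H) (n := n) q z u) (siteR q z v) := by
  intro a a' b b' w
  ext k
  -- `F b b'` is the tensor `e_b ⊗ e_{b'} ⊗ w`. On it both products of site matrices take the shape
  -- of the sides of `yangBaxter`, and `hF` trades the R-matrix on the row indices for the one on
  -- the column indices.
  let F : Fin n → Fin n → Fin n → Fin n → Fin n → H :=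
    fun b b' x y c => if x = b ∧ y = b' then w c else 0
  have hl : ∀ x y : Fin n, siteR q z u x b (siteR q z v y b' w) k
      = rA q u z x k • (rA q v z y k • F b b' x y k + rB q v z y k • F b b' x k y)
        + rB q u z x k • (rA q v z y x • F b b' k y x + rB q v z y x • F b b' k x y) := by
    intro x y
    simp only [siteR_apply, F, ite_and]
    split_ifs <;> module
  have hr : ∀ b b' x y : Fin n, siteR q z v y b' (siteR q z u x b w) k
      = rA q v z y k • (rA q u z x k • F b b' x y k + rB q u z x k • F b b' k y x)
        + rB q v z y k • (rA q u z x y • F b b' x k y + rB q u z x y • F b b' y k x) := by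
    intro b b' x y
    simp only [siteR_apply, F, ite_and]
    split_ifs <;> module
  have hF : ∀ x y c, rA q u v x y • F b b' x y c + rB q u v x y • F b b' y x c
      = rA q u v b b' • F b b' x y c + rB q u v b' b • F b' b x y c := by
    intro x y c
    simp only [F]
    congr 1
    · split_ifs with h
      · rw [h.1, h.2]
      · simp
    · by_cases h : x = b' ∧ y = b
      · rw [if_pos h, if_pos h.symm, h.1, h.2]
      · rw [if_neg h, if_neg fun h' => h h'.symm]; simp
  have h := yangBaxter q huv huz hvz (F b b') a a' k
  simp only [Pi.add_apply, Pi.smul_apply, hl, hr]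
  rw [h]
  simp only [hF]
  module

lemma exchange_compLeft {q u v : ℂ} {X Y : Matrix (Fin n) (Fin n) (Module.End ℂ H)}
    (h : Exchange q u v X Y) (ι : Type*) :
    Exchange q u v (Matrix.of fun a b => (X a b).compLeft ι)
      (Matrix.of fun a b => (Y a b).compLeft ι) := by
  intro a a' b b' w
  ext K
  exact h a a' b b' (w K)

lemma onFirst_mul (X Y : Matrix (Fin n) (Fin n) (Module.End ℂ H)) :
    onFirst (X * Y) = onFirst X * onFirst Y := by
  ext ⟨a, a'⟩ ⟨b, b'⟩ : 2
  simp only [onFirst, Matrix.mul_apply, Matrix.of_apply, Fintype.sum_prod_type]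
  by_cases h : a' = b' <;> simp [h]

lemma onSecond_mul (X Y : Matrix (Fin n) (Fin n) (Module.End ℂ H)) :
    onSecond (X * Y) = onSecond X * onSecond Y := by
  ext ⟨a, a'⟩ ⟨b, b'⟩ : 2
  simp only [onSecond, Matrix.mul_apply, Matrix.of_apply, Fintype.sum_prod_type]
  by_cases h : a = b <;> simp [h]

lemma onFirst_mul_onSecond_comm {X Y : Matrix (Fin n) (Fin n) (Module.End ℂ H)}
    (h : ∀ a b c d, X a b * Y c d = Y c d * X a b) :
    onFirst X * onSecond Y = onSecond Y * onFirst X := by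
  ext ⟨a, a'⟩ ⟨b, b'⟩ : 2
  rw [onFirst_mul_onSecond, onSecond_mul_onFirst, h]

/-- The usual coproduct argument: the entries of `T` and those of the site matrix act on different
tensor factors and commute, so the two RTT relations can be applied one after the other. -/
lemma exchange_siteExt {q : ℂ} {T : ℂ → Matrix (Fin n) (Fin n) (Module.End ℂ H)} {u v z : ℂ}
    (h : Exchange q u v (T u) (T v)) (huv : u ≠ v) (huz : u ≠ z) (hvz : v ≠ z) :
    Exchange q u v (siteExt q T z u) (siteExt q T z v) := by
  have h1 := (rtt_iff_exchange q u v _ _).2 (exchange_compLeft h (Fin n))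
  have h2 := (rtt_iff_exchange q u v _ _).2 (exchange_siteR (H := H) (n := n) q huv huz hvz)
  have hc : ∀ (u v : ℂ) (a b c d : Fin n),
      siteR q z u a b * (T v c d).compLeft (Fin n)
        = (T v c d).compLeft (Fin n) * siteR (H := H) q z u a b := by
    intro u v a b c d
    refine LinearMap.ext fun w => funext fun k => ?_
    simp only [Module.End.mul_apply, LinearMap.compLeft_apply, Function.comp_apply, siteR_apply,
      map_add]
    congr 1
    · by_cases h : a = b <;> simp [h]
    · by_cases h : k = b <;> simp [h]
  rw [← rtt_iff_exchange]
  simp only [siteExt, onFirst_mul, onSecond_mul]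
  have c1 := onFirst_mul_onSecond_comm (X := siteR (H := H) q z u)
    (Y := Matrix.of fun a b => (T v a b).compLeft (Fin n)) (fun a b c d => hc u v a b c d)
  have c2 := onFirst_mul_onSecond_comm (Y := siteR (H := H) q z v)
    (X := Matrix.of fun a b => (T u a b).compLeft (Fin n))
    (fun a b c d => (hc v u c d a b).symm)
  set E := (RMatrix q n u v).map (algebraMap ℂ (Module.End ℂ (Fin n → H)))
  set T₁ := onFirst (Matrix.of fun a b => (T u a b).compLeft (Fin n))
  set T₂ := onSecond (Matrix.of fun a b => (T v a b).compLeft (Fin n))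
  set r₁ := onFirst (siteR (H := H) (n := n) q z u)
  set r₂ := onSecond (siteR (H := H) (n := n) q z v)
  calc E * (T₁ * r₁) * (T₂ * r₂) = E * T₁ * (r₁ * T₂) * r₂ := by simp only [mul_assoc]
    _ = (E * T₁ * T₂) * (r₁ * r₂) := by rw [c1]; simp only [mul_assoc]
    _ = T₂ * T₁ * (E * r₁ * r₂) := by rw [h1]; simp only [mul_assoc]
    _ = T₂ * (T₁ * r₂) * r₁ * E := by rw [h2]; simp only [mul_assoc]
    _ = _ := by rw [c2]; simp only [mul_assoc]

lemma IsModel.siteExt {q : ℂ} {D : Set ℂ}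
    {T : ℂ → Matrix (Fin (n + 1)) (Fin (n + 1)) (Module.End ℂ H)}
    {lam : Fin (n + 1) → ℂ → ℂ} {vac : H} (hT : IsModel q D T lam vac) (z : ℂ) :
    IsModel q (D \ {z}) (siteExt q T z)
      (Fin.cons (fun u => lam 0 u * f q u z) fun i => lam i.succ) (Pi.single 0 vac) := by
  -- The flip part of `R(u,z)` contributes nothing on the vacuum: only `c = 0` can occur, where
  -- either the flip coefficient vanishes (`i = j = 0`) or `T_{i,1}` annihilates the vacuum.
  have h0 : ∀ u ∈ D, ∀ i j : Fin (n + 1), j ≤ i →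
      ∑ c, rB q u z c j • T u i c ((Pi.single 0 vac : Fin (n + 1) → H) c) = 0 := by
    intro u hu i j hij
    rw [Finset.sum_eq_single 0]
    · rcases eq_or_ne i 0 with rfl | hi
      · obtain rfl : j = 0 := by simpa using hij
        simp [rB]
      · rw [Pi.single_eq_same, hT.lower u hu i 0 (Fin.pos_of_ne_zero hi), smul_zero]
    · intro c _ hc
      simp [hc]
    · simp
  refine ⟨fun u hu v hv huv => ?_, fun u hu i => ?_, fun u hu i j hij => ?_⟩
  · exact (rtt_iff_exchange _ _ _ _ _).2
      (exchange_siteExt (hT.exchange hu.1 hv.1 huv) huv hu.2 hv.2)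
  · ext k
    rw [siteExt_apply, h0 u hu.1 i i le_rfl, ite_self, add_zero, Pi.smul_apply]
    rcases eq_or_ne k 0 with rfl | hk
    · rw [Pi.single_eq_same, hT.diag u hu.1]
      refine Fin.cases ?_ (fun i => ?_) i
      · simp [rA, smul_smul, mul_comm]
      · simp [rA]
    · simp [hk]
  · ext k
    rw [siteExt_apply, h0 u hu.1 i j hij.le, ite_self, add_zero]
    rcases eq_or_ne k 0 with rfl | hk
    · simp [hT.lower u hu.1 i j hij]
    · simp [hk]

/-- The components of a vector of `H ⊗ (ℂ^n)^{⊗ r}` along the first tensor factor. -/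
def slice : (List (Fin n) → H) →ₗ[ℂ] (Fin n → List (Fin n) → H) where
  toFun w k L := w (k :: L)
  map_add' _ _ := rfl
  map_smul' _ _ := rfl

/-- The vector with the given components along the first tensor factor. -/
def unslice : (Fin n → List (Fin n) → H) →ₗ[ℂ] (List (Fin n) → H) where
  toFun w L := match L with
    -- Components at lists of the wrong length carry no information; zero keeps the map linear.
    | [] => 0
    | k :: L => w k L
  map_add' w w' := by ext L; cases L <;> simp
  map_smul' c w := by ext L; cases L <;> simp

@[simp] lemma slice_apply (w : List (Fin n) → H) (k : Fin n) (L : List (Fin n)) :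
    slice w k L = w (k :: L) := rfl

@[simp] lemma unslice_nil (w : Fin n → List (Fin n) → H) : unslice w [] = 0 := rfl

@[simp] lemma unslice_cons (w : Fin n → List (Fin n) → H) (k : Fin n) (L : List (Fin n)) :
    unslice w (k :: L) = w k L := rfl

@[simp] lemma slice_unslice (w : Fin n → List (Fin n) → H) : slice (unslice w) = w := rfl

/-- The monodromy matrix `T(u) R_{0,r}(u,t_r) ⋯ R_{0,1}(u,t_1)`. A vector of `H ⊗ (ℂ^n)^{⊗ r}` is
given by its components, labelled by the lists of length `r`. -/
noncomputable def chain (q : ℂ) (T : ℂ → Matrix (Fin n) (Fin n) (Module.End ℂ H)) :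
    List ℂ → ℂ → Matrix (Fin n) (Fin n) (Module.End ℂ (List (Fin n) → H))
  | [], u => Matrix.of fun a b => (T u a b).compLeft (List (Fin n))
  | z :: t, u => Matrix.of fun a b => unslice ∘ₗ siteExt q (chain q T t) z u a b ∘ₗ slice

lemma chain_nil_apply (q : ℂ) (T : ℂ → Matrix (Fin n) (Fin n) (Module.End ℂ H)) (u : ℂ)
    (a b : Fin n) (w : List (Fin n) → H) (L : List (Fin n)) :
    chain q T [] u a b w L = T u a b (w L) := rfl

lemma chain_cons_apply (q : ℂ) (T : ℂ → Matrix (Fin n) (Fin n) (Module.End ℂ H)) (z : ℂ)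
    (t : List ℂ) (u : ℂ) (a b : Fin n) (w : List (Fin n) → H) :
    chain q T (z :: t) u a b w = unslice (siteExt q (chain q T t) z u a b (slice w)) := rfl

lemma slice_chain_cons (q : ℂ) (T : ℂ → Matrix (Fin n) (Fin n) (Module.End ℂ H)) (z : ℂ)
    (t : List ℂ) (u : ℂ) (a b : Fin n) (w : List (Fin n) → H) :
    slice (chain q T (z :: t) u a b w) = siteExt q (chain q T t) z u a b (slice w) := rfl

/-- The vacuum `|0⟩ ⊗ e_1 ⊗ ⋯ ⊗ e_1`. -/
def chainVac (r : ℕ) (vac : H) : List (Fin (n + 1)) → H :=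
  fun L => if L = List.replicate r 0 then vac else 0

lemma slice_chainVac (r : ℕ) (vac : H) :
    slice (chainVac (n := n) (r + 1) vac) = Pi.single 0 (chainVac r vac) := by
  ext k L
  rw [slice_apply, chainVac, List.replicate_succ]
  rcases eq_or_ne k 0 with rfl | hk
  · simp [chainVac]
  · simp [hk]

lemma chainVac_succ (r : ℕ) (vac : H) :
    chainVac (n := n) (r + 1) vac = unslice (Pi.single 0 (chainVac r vac)) := by
  rw [← slice_chainVac]
  ext L
  cases L with
  | nil => simp [chainVac, List.replicate_succ]
  | cons => rfl

/-- The vacuum eigenvalues of `chain q T t`. -/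
noncomputable def chainLam (q : ℂ) (lam : Fin (n + 1) → ℂ → ℂ) (t : List ℂ) :
    Fin (n + 1) → ℂ → ℂ :=
  Fin.cons (fun u => lam 0 u * fProd q [u] t) fun i => lam i.succ

lemma fProd_singleton_cons (q u z : ℂ) (t : List ℂ) :
    fProd q [u] (z :: t) = f q u z * fProd q [u] t := by simp [fProd]

lemma IsModel.chain {q : ℂ} {D : Set ℂ}
    {T : ℂ → Matrix (Fin (n + 1)) (Fin (n + 1)) (Module.End ℂ H)}
    {lam : Fin (n + 1) → ℂ → ℂ} {vac : H} (hT : IsModel q D T lam vac) (t : List ℂ) :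
    IsModel q (D \ {x | x ∈ t}) (chain q T t) (chainLam q lam t) (chainVac t.length vac) := by
  induction t with
  | nil =>
    refine ⟨fun u hu v hv huv => ?_, fun u hu i => ?_, fun u hu i j hij => ?_⟩
    · exact (rtt_iff_exchange _ _ _ _ _).2
        (exchange_compLeft (hT.exchange hu.1 hv.1 huv) (List (Fin (n + 1))))
    · ext L
      rw [chain_nil_apply, chainVac, Pi.smul_apply]
      have : chainLam q lam [] i u = lam i u := by
        refine Fin.cases ?_ (fun i => ?_) i <;> simp [chainLam, fProd]
      rw [this, chainVac]
      split_ifs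
      · exact hT.diag u hu.1 i
      · simp
    · ext L
      rw [chain_nil_apply, chainVac]
      split_ifs <;> simp [hT.lower u hu.1 i j hij]
  | cons z t ih =>
    have h := ih.siteExt z
    have hD : ∀ u, u ∈ D \ {x | x ∈ z :: t} → u ∈ (D \ {x | x ∈ t}) \ {z} := by
      intro u hu
      simp only [Set.mem_sdiff, Set.mem_ofPred_eq, List.mem_cons, not_or,
        Set.mem_singleton_iff] at hu ⊢
      tauto
    refine ⟨fun u hu v hv huv => ?_, fun u hu i => ?_, fun u hu i j hij => ?_⟩
    · refine (rtt_iff_exchange _ _ _ _ _).2 fun a a' b b' w => ?_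
      have := h.exchange (hD u hu) (hD v hv) huv a a' b b' (slice w)
      simpa only [chain_cons_apply, slice_unslice, map_smul, map_add] using congrArg unslice this
    · rw [List.length_cons, chainVac_succ, chain_cons_apply, slice_unslice, h.diag u (hD u hu),
        map_smul]
      congr 1
      refine Fin.cases ?_ (fun i => ?_) i
      · simp only [chainLam, Fin.cons_zero, fProd_singleton_cons]; ring
      · simp [chainLam]
    · rw [List.length_cons, chainVac_succ, chain_cons_apply, slice_unslice,
        h.lower u (hD u hu) i j hij, map_zero]

end

/-! ### Transport of Bethe vectors along linear relations -/

section
variable {H H₁ H₂ : Type u} [AddCommGroup H] [Module ℂ H] [AddCommGroup H₁] [Module ℂ H₁]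
  [AddCommGroup H₂] [Module ℂ H₂] {n : ℕ}

/-- The relation `S`, imposed on all components of vectors of `H ⊗ V`. -/
def pointwiseRel (ι : Type) (S : Submodule ℂ (H₁ × H₂)) :
    Submodule ℂ ((ι → H₁) × (ι → H₂)) where
  carrier := {w | ∀ K, (w.1 K, w.2 K) ∈ S}
  zero_mem' _ := S.zero_mem
  add_mem' h h' K := S.add_mem (h K) (h' K)
  smul_mem' c _ h K := S.smul_mem c (h K)

lemma sum_mk_mem {ι : Type*} (s : Finset ι) {S : Submodule ℂ (H₁ × H₂)} {x : ι → H₁} {y : ι → H₂}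
    (h : ∀ i ∈ s, (x i, y i) ∈ S) : (∑ i ∈ s, x i, ∑ i ∈ s, y i) ∈ S := by
  have e : (∑ i ∈ s, x i, ∑ i ∈ s, y i) = ∑ i ∈ s, (x i, y i) :=
    Prod.ext (by simp [Prod.fst_sum]) (by simp [Prod.snd_sum])
  exact e ▸ S.sum_mem h

lemma prod_rel {ι : Type*} (l : List ι) (A₁ : ι → Matrix (Fin n) (Fin n) (Module.End ℂ H₁))
    (A₂ : ι → Matrix (Fin n) (Fin n) (Module.End ℂ H₂)) (S : Submodule ℂ (H₁ × H₂))
    (h : ∀ i ∈ l, ∀ a b, ∀ w ∈ S, (A₁ i a b w.1, A₂ i a b w.2) ∈ S) (a b : Fin n)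
    (w : H₁ × H₂) (hw : w ∈ S) :
    ((l.map A₁).prod a b w.1, (l.map A₂).prod a b w.2) ∈ S := by
  induction l generalizing a with
  | nil =>
    by_cases hab : a = b
    · simpa [hab] using hw
    · simp only [List.map_nil, List.prod_nil, Matrix.one_apply_ne hab, LinearMap.zero_apply]
      exact S.zero_mem
  | cons i l ih =>
    simp only [List.map_cons, List.prod_cons, Matrix.mul_apply, LinearMap.sum_apply,
      Module.End.mul_apply]
    exact sum_mk_mem _ fun c _ => h i (by simp) _ _ (_, _)
      (ih (fun j hj => h j (List.mem_cons_of_mem _ hj)) c)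

lemma inhomMonodromy_rel (q : ℂ) (ts : List ℂ) (u : ℂ) (S : Submodule ℂ (H₁ × H₂)) (a b : Fin n)
    (w : ((Fin ts.length → Fin n) → H₁) × ((Fin ts.length → Fin n) → H₂))
    (hw : w ∈ pointwiseRel _ S) :
    (inhomMonodromy q n ts u a b w.1, inhomMonodromy q n ts u a b w.2) ∈ pointwiseRel _ S := by
  simp only [inhomMonodromy, List.ofFn_eq_map, ← List.map_reverse]
  refine prod_rel _ _ _ _ (fun s _ a b w hw K => ?_) a b w hw
  exact sum_mk_mem Finset.univ
    (x := fun d => RMatrix q n u (ts.get s) (a, K s) (b, d) • w.1 (Function.update K s d))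
    (y := fun d => RMatrix q n u (ts.get s) (a, K s) (b, d) • w.2 (Function.update K s d))
    fun d _ => S.smul_mem _ (hw _)

lemma nestedMonodromy_rel (q : ℂ)
    (T₁ : ℂ → Matrix (Fin (n + 1)) (Fin (n + 1)) (Module.End ℂ H₁))
    (T₂ : ℂ → Matrix (Fin (n + 1)) (Fin (n + 1)) (Module.End ℂ H₂)) (ts : List ℂ) (u : ℂ)
    (S S' : Submodule ℂ (H₁ × H₂))
    (h : ∀ a b, ∀ w ∈ S, (T₁ u a b w.1, T₂ u a b w.2) ∈ S') (a b : Fin n)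
    (w : ((Fin ts.length → Fin n) → H₁) × ((Fin ts.length → Fin n) → H₂))
    (hw : w ∈ pointwiseRel _ S) :
    (nestedMonodromy q T₁ ts u a b w.1, nestedMonodromy q T₂ ts u a b w.2)
      ∈ pointwiseRel _ S' := by
  intro K
  simp only [nestedMonodromy, Matrix.mul_apply, LinearMap.sum_apply, Finset.sum_apply]
  exact sum_mk_mem _ fun c _ => h _ _ (_, _) (inhomMonodromy_rel q ts u S c b w hw K)

/-- The rightmost operator acts first, so the list of parameters already used grows at its front.
Indexing the relation by this list allows it to weaken at points already used. -/
lemma ofFn_prod_rel (T₁ : ℂ → Matrix (Fin (n + 1)) (Fin (n + 1)) (Module.End ℂ H₁))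
    (T₂ : ℂ → Matrix (Fin (n + 1)) (Fin (n + 1)) (Module.End ℂ H₂))
    (Rel : List ℂ → Submodule ℂ (H₁ × H₂)) (F ts : List ℂ)
    (hT : ∀ x F', (x :: F') <:+ ts ++ F → ∀ a b, ∀ w ∈ Rel F',
      (T₁ x a b w.1, T₂ x a b w.2) ∈ Rel (x :: F'))
    (K : Fin ts.length → Fin n) (w : H₁ × H₂) (hw : w ∈ Rel F) :
    ((List.ofFn fun s => T₁ (ts.get s) 0 (K s).succ).prod w.1,
      (List.ofFn fun s => T₂ (ts.get s) 0 (K s).succ).prod w.2) ∈ Rel (ts ++ F) := by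
  induction ts with
  | nil => simpa using hw
  | cons x ts ih =>
    simp only [List.length_cons, List.ofFn_succ, List.prod_cons, Module.End.mul_apply]
    exact hT x (ts ++ F) (List.suffix_refl _) _ _ (_, _)
      (ih (fun y F' hF => hT y F' (hF.trans (List.suffix_cons _ _))) fun s => K s.succ)

/-- Bethe vectors of models which are related by linear relations are related. -/
theorem betheVector_rel (q : ℂ) (N : ℕ) {H₁ H₂ : Type u} [AddCommGroup H₁] [Module ℂ H₁]
    [AddCommGroup H₂] [Module ℂ H₂]
    (T₁ : ℂ → Matrix (Fin (N + 1)) (Fin (N + 1)) (Module.End ℂ H₁))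
    (T₂ : ℂ → Matrix (Fin (N + 1)) (Fin (N + 1)) (Module.End ℂ H₂))
    (lam₁ lam₂ : Fin (N + 1) → ℂ → ℂ) (vac₁ : H₁) (vac₂ : H₂) (t : Fin N → List ℂ)
    (Rel : List ℂ → Submodule ℂ (H₁ × H₂))
    (hT : ∀ x F, (x :: F) <:+ (List.ofFn t).flatten → ∀ a b, ∀ w ∈ Rel F,
      (T₁ x a b w.1, T₂ x a b w.2) ∈ Rel (x :: F))
    (hlam : ∀ k : Fin N, ∀ x ∈ t k, lam₁ k.succ x = lam₂ k.succ x)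
    (hvac : (vac₁, vac₂) ∈ Rel []) :
    (betheVector q N T₁ lam₁ vac₁ t, betheVector q N T₂ lam₂ vac₂ t)
      ∈ Rel (List.ofFn t).flatten := by
  -- The spaces vary because each nesting step tensors them with auxiliary factors; the relation is
  -- then imposed componentwise. The first eigenvalue, the only one which nesting modifies, never
  -- enters a Bethe vector, whence the restriction of `hlam` to `k.succ`.
  induction N generalizing H₁ H₂ with
  | zero => simpa [betheVector] using hvac
  | succ N ih =>
    rw [List.ofFn_succ, List.flatten_cons] at hT ⊢
    have h0 : (t 0).map (lam₁ 1) = (t 0).map (lam₂ 1) :=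
      List.map_congr_left fun x hx => hlam 0 x hx
    simp only [betheVector, h0]
    refine (Rel _).smul_mem _ (sum_mk_mem _ fun K _ => ?_)
    refine ofFn_prod_rel T₁ T₂ Rel _ _ hT K (_, _) ?_
    refine ih _ _ _ _ _ _ (fun k => t k.succ) (fun F => pointwiseRel _ (Rel F)) ?_ ?_ ?_ K
    · intro x F hF a b w hw
      exact nestedMonodromy_rel q T₁ T₂ _ x (Rel F) (Rel (x :: F))
        (hT x F (hF.trans (List.suffix_append _ _))) a b w hw
    · intro k x hx
      exact hlam k.succ x hx
    · intro K
      simp only [nestedVacuum]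
      split_ifs
      · exact hvac
      · exact (Rel []).zero_mem

/-! ### Nested Bethe vectors with components indexed by lists -/

/-- The lower right block of a monodromy matrix. -/
def lower (T : ℂ → Matrix (Fin (n + 1)) (Fin (n + 1)) (Module.End ℂ H)) (u : ℂ) :
    Matrix (Fin n) (Fin n) (Module.End ℂ H) :=
  Matrix.of fun a b => T u a.succ b.succ

lemma siteOp_apply (q : ℂ) {r : ℕ} (u ξ : ℂ) (s : Fin r) (a b : Fin n)
    (w : (Fin r → Fin n) → H) (K : Fin r → Fin n) :
    siteOp q u ξ s a b w K = (if a = b then rA q u ξ a (K s) • w K else 0)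
      + if K s = b then rB q u ξ a (K s) • w (Function.update K s a) else 0 := by
  change ∑ d : Fin n, RMatrix q n u ξ (a, K s) (b, d) • w (Function.update K s d) = _
  simp only [RMatrix_apply, add_smul, Finset.sum_add_distrib]
  congr 1
  · rw [Finset.sum_eq_single (K s)]
    · simp
    · intro d _ hd
      simp [Ne.symm hd]
    · simp
  · rw [Finset.sum_eq_single a]
    · simp
    · intro d _ hd
      simp [Ne.symm hd]
    · simp

lemma inhomMonodromy_cons (q z : ℂ) (ts : List ℂ) (u : ℂ) (a b : Fin n)
    (w : (Fin (ts.length + 1) → Fin n) → H) (k : Fin n) (K : Fin ts.length → Fin n) :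
    inhomMonodromy q n (z :: ts) u a b w (Fin.cons k K)
      = ∑ c, inhomMonodromy q n ts u a c
          (fun K => siteOp q u z (0 : Fin (ts.length + 1)) c b w (Fin.cons k K)) K := by
  simp only [inhomMonodromy]
  simp only [List.length_cons, List.ofFn_succ, List.reverse_cons, List.prod_append,
    List.prod_singleton, Matrix.mul_apply, LinearMap.sum_apply, Finset.sum_apply,
    Module.End.mul_apply]
  refine Finset.sum_congr rfl fun c _ => ?_
  simp only [List.ofFn_eq_map, ← List.map_reverse]
  -- The relation "restriction to first index `k`": the sites after the first do not touch that
  -- index, so their product respects it.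
  let S : Submodule ℂ (((Fin (ts.length + 1) → Fin n) → H) × ((Fin ts.length → Fin n) → H)) :=
    { carrier := {w | ∀ K, w.1 (Fin.cons k K) = w.2 K}
      zero_mem' := fun _ => rfl
      add_mem' := fun h h' K => congrArg₂ (· + ·) (h K) (h' K)
      smul_mem' := fun c _ h K => congrArg (c • ·) (h K) }
  refine prod_rel (List.finRange ts.length).reverse
    (fun s => Matrix.of fun a b => siteOp q u (ts.get s) s.succ a b)
    (fun s => Matrix.of fun a b => siteOp q u (ts.get s) s a b) S (fun s _ a b w hw K => ?_) a c
    (siteOp q u z (0 : Fin (ts.length + 1)) c b w, _) (fun K => rfl) K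
  simp only [Matrix.of_apply, siteOp_apply, Fin.cons_succ, ← Fin.cons_update, hw _]

/-- In both presentations `R_{0,1}` is the rightmost factor, so the induction peels off the first
site. -/
lemma blockMul_inhomMonodromy (q : ℂ) (M : ℂ → Matrix (Fin n) (Fin n) (Module.End ℂ H))
    (ts : List ℂ) (u : ℂ) (a b : Fin n) (w : List (Fin n) → H) (K : Fin ts.length → Fin n) :
    ∑ c, M u a c (inhomMonodromy q n ts u c b (fun K => w (List.ofFn K)) K)
      = chain q M ts u a b w (List.ofFn K) := by
  induction ts generalizing b w with
  | nil =>
    rw [chain_nil_apply, Finset.sum_eq_single b]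
    · simp [inhomMonodromy]
    · intro c _ hc
      simp [inhomMonodromy, hc]
    · simp
  | cons z ts ih =>
    obtain ⟨k, K, rfl⟩ : ∃ k K', K = Fin.cons k K' := ⟨K 0, Fin.tail K, (Fin.cons_self_tail K).symm⟩
    have h : ∀ c, (fun K : Fin ts.length → Fin n =>
        siteOp q u z (0 : Fin (ts.length + 1)) c b (fun K => w (List.ofFn K)) (Fin.cons k K))
        = fun K => ((if c = b then rA q u z c k • slice w k else 0)
          + if k = b then rB q u z c k • slice w c else 0) (List.ofFn K) := by
      intro c
      ext K
      rw [siteOp_apply]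
      simp only [Fin.cons_zero, Fin.update_cons_zero]
      split_ifs <;> simp [List.ofFn_succ]
    refine (Finset.sum_congr rfl fun c _ => congrArg (M u a c)
      (inhomMonodromy_cons q z ts u c b (fun K => w (List.ofFn K)) k K)).trans ?_
    simp only [map_sum, h]
    rw [Finset.sum_comm]
    simp only [ih]
    rw [chain_cons_apply]
    simp only [List.length_cons, List.ofFn_succ, Fin.cons_zero, Fin.cons_succ, unslice_cons,
      siteExt_apply, map_add, Pi.add_apply, Finset.sum_add_distrib]
    congr 1
    · rw [Finset.sum_eq_single b] <;> simp +contextual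
    · by_cases hk : k = b <;> simp [hk]

lemma nestedMonodromy_ofFn (q : ℂ)
    (T : ℂ → Matrix (Fin (n + 1)) (Fin (n + 1)) (Module.End ℂ H)) (ts : List ℂ) (u : ℂ)
    (a b : Fin n) (w : List (Fin n) → H) (K : Fin ts.length → Fin n) :
    nestedMonodromy q T ts u a b (fun K => w (List.ofFn K)) K
      = chain q (lower T) ts u a b w (List.ofFn K) := by
  rw [← blockMul_inhomMonodromy]
  simp only [nestedMonodromy, Matrix.mul_apply, LinearMap.sum_apply, Finset.sum_apply]
  rfl

/-- The Bethe vector of the nested model, with components labelled by lists. -/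
noncomputable def nestedBethe (q : ℂ) {N : ℕ}
    (T : ℂ → Matrix (Fin (N + 2)) (Fin (N + 2)) (Module.End ℂ H)) (lam : Fin (N + 2) → ℂ → ℂ)
    (vac : H) (t : Fin N → List ℂ) (ts : List ℂ) : List (Fin (N + 1)) → H :=
  betheVector q N (chain q (lower T) ts) (fun i => lam i.succ) (chainVac ts.length vac) t

/-- Instance of `betheVector_rel` for the graph of restriction to lists of length `r`. The two
families of eigenvalues differ only in the first one, which plays no role. -/
lemma betheVector_nested_ofFn (q : ℂ) {N : ℕ}
    (T : ℂ → Matrix (Fin (N + 2)) (Fin (N + 2)) (Module.End ℂ H)) (lam : Fin (N + 2) → ℂ → ℂ)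
    (vac : H) (t : Fin N → List ℂ) (ts : List ℂ) (K : Fin ts.length → Fin (N + 1)) :
    betheVector q N (nestedMonodromy q T ts) (nestedLam q lam ts) (nestedVacuum N vac ts) t K
      = nestedBethe q T lam vac t ts (List.ofFn K) := by
  let S : Submodule ℂ
      ((List (Fin (N + 1)) → H) × ((Fin ts.length → Fin (N + 1)) → H)) :=
    { carrier := {w | w.2 = fun K => w.1 (List.ofFn K)}
      zero_mem' := rfl
      add_mem' := fun h h' => congrArg₂ (· + ·) h h'
      smul_mem' := fun c _ h => congrArg (c • ·) h }
  refine congrFun (betheVector_rel q N (chain q (lower T) ts) (nestedMonodromy q T ts)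
    (fun i => lam i.succ) (nestedLam q lam ts) (chainVac ts.length vac) (nestedVacuum N vac ts) t
    (fun _ => S) ?_ ?_ ?_ : _ ∈ S) K
  · intro x F _ a b w hw
    ext K
    change nestedMonodromy q T ts x a b w.2 K = chain q (lower T) ts x a b w.1 (List.ofFn K)
    rw [← nestedMonodromy_ofFn, show w.2 = _ from hw]
  · intro k x _
    rfl
  · ext K
    simp only [nestedVacuum, chainVac, List.eq_replicate_iff, List.length_ofFn, true_and,
      List.mem_ofFn, forall_exists_index, forall_apply_eq_imp_iff]

/-- The sum `∑ T_{1,k_1}(t_1) ⋯ T_{1,k_r}(t_r) [Φ]_{k_1,…,k_r}`. -/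
noncomputable def creationSum (T : ℂ → Matrix (Fin (n + 1)) (Fin (n + 1)) (Module.End ℂ H)) :
    List ℂ → (List (Fin n) → H) → H
  | [], Φ => Φ []
  | x :: ts, Φ => ∑ k : Fin n, T x 0 k.succ (creationSum T ts fun L => Φ (k :: L))

lemma sum_ofFn_prod (T : ℂ → Matrix (Fin (n + 1)) (Fin (n + 1)) (Module.End ℂ H)) (ts : List ℂ)
    (Φ : List (Fin n) → H) :
    ∑ K : Fin ts.length → Fin n,
      (List.ofFn fun s => T (ts.get s) 0 (K s).succ).prod (Φ (List.ofFn K))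
      = creationSum T ts Φ := by
  induction ts generalizing Φ with
  | nil => simp [creationSum]
  | cons x ts ih =>
    refine ((Fin.consEquiv fun _ : Fin (ts.length + 1) => Fin n).sum_comp
      (fun K => (List.ofFn fun s : Fin (ts.length + 1) =>
        T ((x :: ts).get s) 0 (K s).succ).prod (Φ (List.ofFn K)))).symm.trans ?_
    rw [creationSum, Fintype.sum_prod_type]
    refine Finset.sum_congr rfl fun k _ => ?_
    rw [← ih, map_sum]
    refine Finset.sum_congr rfl fun K _ => ?_
    simp [List.ofFn_succ, Fin.consEquiv]

theorem betheVector_succ (q : ℂ) {N : ℕ}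
    (T : ℂ → Matrix (Fin (N + 2)) (Fin (N + 2)) (Module.End ℂ H)) (lam : Fin (N + 2) → ℂ → ℂ)
    (vac : H) (t : Fin (N + 1) → List ℂ) :
    betheVector q (N + 1) T lam vac t
      = (((t 0).map (lam 1)).prod * fProd q (colorSet t 1) (t 0))⁻¹ •
        creationSum T (t 0) (nestedBethe q T lam vac (fun k => t k.succ) (t 0)) := by
  rw [betheVector, ← sum_ofFn_prod]
  simp only [betheVector_nested_ofFn]

end

/-! ### Singular vectors and the exchange of inhomogeneities -/

section
variable {H H₁ H₂ : Type u} [AddCommGroup H] [Module ℂ H] [AddCommGroup H₁] [Module ℂ H₁]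
  [AddCommGroup H₂] [Module ℂ H₂] {n : ℕ}

lemma siteExt_rel (q z u : ℂ) (T₁ : ℂ → Matrix (Fin n) (Fin n) (Module.End ℂ H₁))
    (T₂ : ℂ → Matrix (Fin n) (Fin n) (Module.End ℂ H₂)) (S S' : Submodule ℂ (H₁ × H₂))
    (h : ∀ a b, ∀ w ∈ S, (T₁ u a b w.1, T₂ u a b w.2) ∈ S') (a b : Fin n)
    (w₁ : Fin n → H₁) (w₂ : Fin n → H₂) (hw : ∀ k, (w₁ k, w₂ k) ∈ S) (k : Fin n) :
    (siteExt q T₁ z u a b w₁ k, siteExt q T₂ z u a b w₂ k) ∈ S' := by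
  by_cases hk : k = b
  · simp only [siteExt_apply, if_pos hk]
    exact S'.add_mem (S'.smul_mem (rA q u z b k) (h a b _ (hw k)))
      (sum_mk_mem Finset.univ (x := fun c => rB q u z c b • T₁ u a c (w₁ c))
        (y := fun c => rB q u z c b • T₂ u a c (w₂ c))
        fun c _ => S'.smul_mem _ (h a c _ (hw c)))
  · simp only [siteExt_apply, if_neg hk, add_zero]
    exact S'.smul_mem (rA q u z b k) (h a b _ (hw k))

lemma chain_rel (q u : ℂ) (ts : List ℂ) (T₁ : ℂ → Matrix (Fin n) (Fin n) (Module.End ℂ H₁))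
    (T₂ : ℂ → Matrix (Fin n) (Fin n) (Module.End ℂ H₂)) (S S' : Submodule ℂ (H₁ × H₂))
    (h : ∀ a b, ∀ w ∈ S, (T₁ u a b w.1, T₂ u a b w.2) ∈ S') (a b : Fin n)
    (w : (List (Fin n) → H₁) × (List (Fin n) → H₂)) (hw : w ∈ pointwiseRel _ S) :
    (chain q T₁ ts u a b w.1, chain q T₂ ts u a b w.2) ∈ pointwiseRel _ S' := by
  induction ts generalizing a b w with
  | nil => exact fun L => h a b _ (hw L)
  | cons z ts ih =>
    intro L
    cases L with
    | nil => exact S'.zero_mem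
    | cons k L =>
      exact siteExt_rel q z u _ _ (pointwiseRel _ S) (pointwiseRel _ S') ih a b (slice w.1)
        (slice w.2) (fun k L => hw (k :: L)) k L

/-- The vector `w` behaves at the point `x` like the pseudovacuum under the first column of `T`. -/
def IsSingular (T : ℂ → Matrix (Fin (n + 1)) (Fin (n + 1)) (Module.End ℂ H))
    (lam : Fin (n + 1) → ℂ → ℂ) (x : ℂ) (w : H) : Prop :=
  T x 0 0 w = lam 0 x • w ∧ ∀ i : Fin n, T x i.succ 0 w = 0

/-- In the RTT relation with second column index 1, both terms with exchanged indices contain an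
entry of the first column below the diagonal, which annihilates `w`. The operator `T_{a',1}(v)` thus
passes through with coefficient 1 from the columns. -/
lemma IsSingular.lower {q : ℂ} {D : Set ℂ}
    {T : ℂ → Matrix (Fin (n + 1)) (Fin (n + 1)) (Module.End ℂ H)} {lam : Fin (n + 1) → ℂ → ℂ}
    {vac : H} (hT : IsModel q D T lam vac) {u v : ℂ} (hu : u ∈ D) (hv : v ∈ D) (huv : u ≠ v)
    {w : H} (hwu : IsSingular T lam u w) (hwv : IsSingular T lam v w) (j k : Fin n) :
    IsSingular T lam v (T u j.succ k.succ w) := by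
  have h : ∀ a', T v a' 0 (T u j.succ k.succ w)
      = rA q u v j.succ a' • T u j.succ k.succ (T v a' 0 w) := by
    intro a'
    have := hT.exchange hu hv huv j.succ a' k.succ 0 w
    rw [hwu.2 j, hwv.2 j] at this
    simpa [rA] using this.symm
  refine ⟨?_, fun i => ?_⟩
  · rw [h, hwv.1, map_smul]
    simp [rA]
  · rw [h, hwv.2, map_zero, smul_zero]

/-- The vectors `|w⟩ ⊗ e_1` with `w` singular outside of `F`, paired with `w`. -/
def singularRel (D : Set ℂ) (T : ℂ → Matrix (Fin (n + 1)) (Fin (n + 1)) (Module.End ℂ H))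
    (lam : Fin (n + 1) → ℂ → ℂ) (F : List ℂ) : Submodule ℂ ((Fin (n + 1) → H) × H) where
  carrier := {w | w.1 = Pi.single 0 w.2 ∧ ∀ v ∈ D, v ∉ F → IsSingular T lam v w.2}
  zero_mem' := ⟨by simp, fun v _ _ => ⟨by simp, by simp⟩⟩
  add_mem' := fun {w w'} h h' => ⟨by simp [h.1, h'.1, Pi.single_add], fun v hv hF =>
    ⟨by simp [(h.2 v hv hF).1, (h'.2 v hv hF).1],
      fun i => by simp [(h.2 v hv hF).2, (h'.2 v hv hF).2]⟩⟩
  smul_mem' := fun c w h => ⟨by simp [h.1, Pi.single_smul], fun v hv hF =>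
    ⟨by simp [(h.2 v hv hF).1, smul_comm c], fun i => by simp [(h.2 v hv hF).2]⟩⟩

/-- The factor `e_1` is a spectator: for auxiliary indices at least 2 the identity part of `R(x,z)`
has coefficient 1 on it, and the flip part brings in an entry of the first column, which annihilates
singular vectors. Singularity at `v` survives the lower block at every point other than `v`; as the
parameters are distinct, it is available whenever the next one is used. -/
theorem nestedBethe_siteExt {q : ℂ} {D : Set ℂ} {N : ℕ}
    {T : ℂ → Matrix (Fin (N + 2)) (Fin (N + 2)) (Module.End ℂ H)} {lam : Fin (N + 2) → ℂ → ℂ}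
    {vac : H} (hT : IsModel q D T lam vac) (z : ℂ) (lam' : Fin (N + 2) → ℂ → ℂ)
    (hlam : ∀ i : Fin (N + 1), lam' i.succ = lam i.succ) (t : Fin N → List ℂ)
    (hD : ∀ x ∈ (List.ofFn t).flatten, x ∈ D) (hnd : (List.ofFn t).flatten.Nodup)
    (ts : List ℂ) (L : List (Fin (N + 1))) :
    nestedBethe q (siteExt q T z) lam' (Pi.single 0 vac) t ts L
        = Pi.single 0 (nestedBethe q T lam vac t ts L)
      ∧ ∀ v ∈ D, v ∉ (List.ofFn t).flatten →
          IsSingular T lam v (nestedBethe q T lam vac t ts L) := by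
  have hl : (fun i : Fin (N + 1) => lam' i.succ) = fun i => lam i.succ := funext hlam
  refine betheVector_rel q N (chain q (UqBethe.lower (UqBethe.siteExt q T z)) ts)
    (chain q (UqBethe.lower T) ts) _ _ _ _ t (fun F => pointwiseRel _ (singularRel D T lam F))
    ?_ ?_ ?_ L
  · intro x F hF a b w hw
    have hxF : x ∉ F := (List.nodup_cons.1 (hF.sublist.nodup hnd)).1
    have hx : x ∈ D := hD x (hF.subset (by simp))
    refine chain_rel q x ts _ _ (singularRel D T lam F) (singularRel D T lam (x :: F))
      (fun a b w hw => ⟨?_, ?_⟩) a b w hw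
    · ext k
      have h0 : ∑ c, rB q x z c b.succ • T x a.succ c (w.1 c) = 0 := by
        rw [Finset.sum_eq_single 0]
        · rw [hw.1, Pi.single_eq_same, (hw.2 x hx hxF).2, smul_zero]
        · intro c _ hc
          simp [hw.1, hc]
        · simp
      change UqBethe.siteExt q T z x a.succ b.succ w.1 k
        = (Pi.single 0 (T x a.succ b.succ w.2) : Fin (N + 2) → H) k
      rw [siteExt_apply, h0, ite_self, add_zero, hw.1]
      rcases eq_or_ne k 0 with rfl | hk
      · simp [rA]
      · simp [hk]
    · intro v hv hvF
      rw [List.mem_cons, not_or] at hvF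
      exact (hw.2 x hx hxF).lower hT hx hv (Ne.symm hvF.1) (hw.2 v hv hvF.2) a b
  · intro k x _
    rw [hlam]
  · intro L
    simp only [chainVac]
    split_ifs
    · exact ⟨rfl, fun v hv _ => ⟨hT.diag v hv 0, fun i => hT.lower v hv _ _ (Fin.succ_pos i)⟩⟩
    · exact Submodule.zero_mem _

lemma chain_cons_cons_apply (q : ℂ) (T : ℂ → Matrix (Fin n) (Fin n) (Module.End ℂ H))
    (a b : ℂ) (ts : List ℂ) (u : ℂ) (i j : Fin n) (w : List (Fin n) → H) (k l : Fin n)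
    (L : List (Fin n)) (F : Fin n → Fin n → Fin n → List (Fin n) → H)
    (hF : F = fun x k l L => if x = j then w (k :: l :: L) else 0) :
    chain q T (a :: b :: ts) u i j w (k :: l :: L) = ∑ e, chain q T ts u i e
      (rA q u b e l • (rA q u a e k • F e k l + rB q u a e k • F k e l)
        + rB q u b e l • (rA q u a l k • F l k e + rB q u a l k • F k l e)) L := by
  have h : ∀ (M : List ℂ) (z : ℂ) (i j : Fin n) (w : List (Fin n) → H) (k : Fin n)
      (L : List (Fin n)), chain q T (z :: M) u i j w (k :: L)
        = ∑ c, chain q T M u i c (siteR q z u c j (slice w) k) L := by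
    intro M z i j w k L
    rw [chain_cons_apply, unslice_cons, siteExt, Matrix.mul_apply, LinearMap.sum_apply,
      Finset.sum_apply, Finset.sum_apply]
    rfl
  rw [h]
  simp only [h]
  rw [Finset.sum_comm]
  refine Finset.sum_congr rfl fun e _ => ?_
  rw [← Finset.sum_apply, ← map_sum]
  refine congrFun (congrArg _ ?_) L
  simp only [siteR_apply, Finset.sum_add_distrib]
  congr 1
  · rw [Finset.sum_ite_eq, if_pos (Finset.mem_univ _)]
    ext L
    subst hF
    simp only [slice_apply, Pi.smul_apply, Pi.add_apply]
    split_ifs <;> simp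
  · rw [Finset.sum_ite_eq, if_pos (Finset.mem_univ _)]
    ext L
    subst hF
    simp only [slice_apply, Pi.smul_apply, Pi.add_apply]
    split_ifs <;> simp

/-- The relation between the components of Bethe vectors with exchanged inhomogeneities `a`, `b` at
the positions `r + 1`, `r + 2`. -/
def exchangeRel (H : Type u) [AddCommGroup H] [Module ℂ H] (q : ℂ) (n r : ℕ) (a b : ℂ) :
    Submodule ℂ ((List (Fin n) → H) × (List (Fin n) → H)) where
  carrier := {w | ∀ P k l L, P.length = r → f q b a • w.2 (P ++ k :: l :: L)
    = rA q b a l k • w.1 (P ++ l :: k :: L) + rB q b a l k • w.1 (P ++ k :: l :: L)}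
  zero_mem' := by intro P k l L _; simp
  add_mem' := by
    intro w w' h h' P k l L hP
    simp only [Prod.snd_add, Prod.fst_add, Pi.add_apply, smul_add, h P k l L hP, h' P k l L hP]
    module
  smul_mem' := by
    intro c w h P k l L hP
    simp only [Prod.smul_fst, Prod.smul_snd, Pi.smul_apply, smul_comm _ c, h P k l L hP, smul_add]

/-- For adjacent sites at the front this is the Yang–Baxter equation with parameters `u`, `b`, `a`;
the sites of `p` put before them are spectators. -/
lemma chain_exchangeRel (q : ℂ) (T : ℂ → Matrix (Fin n) (Fin n) (Module.End ℂ H))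
    {a b u : ℂ} (hab : b ≠ a) (hua : u ≠ a) (hub : u ≠ b) (p s : List ℂ) (i j : Fin n)
    (w : (List (Fin n) → H) × (List (Fin n) → H)) (hw : w ∈ exchangeRel H q n p.length a b) :
    (chain q T (p ++ b :: a :: s) u i j w.1, chain q T (p ++ a :: b :: s) u i j w.2)
      ∈ exchangeRel H q n p.length a b := by
  induction p generalizing i j w with
  | nil =>
    intro P k l L hP
    obtain rfl := List.length_eq_zero_iff.1 hP
    simp only [List.nil_append]
    let F : (List (Fin n) → H) → Fin n → Fin n → Fin n → List (Fin n) → H :=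
      fun w x k l L => if x = j then w (k :: l :: L) else 0
    rw [chain_cons_cons_apply q T _ _ s u i j w.1 l k L (F w.1) rfl,
      chain_cons_cons_apply q T _ _ s u i j w.1 k l L (F w.1) rfl,
      chain_cons_cons_apply q T _ _ s u i j w.2 k l L (F w.2) rfl]
    have hF : ∀ x k l, f q b a • F w.2 x k l
        = rA q b a l k • F w.1 x l k + rB q b a l k • F w.1 x k l := by
      intro x k l
      ext L
      have := hw [] k l L rfl
      simp only [List.nil_append] at this
      simp only [F, Pi.smul_apply, Pi.add_apply]
      split_ifs
      · exact this
      · simp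
    simp only [Finset.smul_sum, ← Finset.sum_add_distrib]
    refine Finset.sum_congr rfl fun e _ => ?_
    have h := yangBaxter q hub hua hab (F w.1) e l k
    simp only [← hF] at h
    have hM : ∀ (c₀ c₁ c₂ : ℂ) (X Y Z : List (Fin n) → H), c₀ • X = c₁ • Y + c₂ • Z →
        c₀ • chain q T s u i e X L
          = c₁ • chain q T s u i e Y L + c₂ • chain q T s u i e Z L := by
      intro c₀ c₁ c₂ X Y Z h
      have h' := congrFun (congrArg (chain q T s u i e) h) L
      simp only [map_add, map_smul] at h'
      exact h'
    refine hM _ _ _ _ _ _ (Eq.trans ?_ h)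
    module
  | cons z p ih =>
    intro P k l L hP
    obtain ⟨d, P, rfl⟩ := List.exists_cons_of_length_eq_add_one hP
    have hP' : P.length = p.length := by simpa using hP
    simp only [List.cons_append, chain_cons_apply, unslice_cons]
    exact siteExt_rel q z u _ _ (exchangeRel H q n p.length a b) _ ih i j (slice w.1) (slice w.2)
      (fun d P k l L hP => hw (d :: P) k l L (by simp [hP])) d P k l L hP'

/-- The family `Φ` of tensors, labelled by the orderings of `t`, satisfies the exchange relations of
nested Bethe vectors. -/
def Exchangeable (q : ℂ) (t : List ℂ) (Φ : List ℂ → List (Fin n) → H) : Prop :=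
  ∀ p a b s, (p ++ a :: b :: s).Perm t → ∀ P k l L, P.length = p.length →
    f q b a • Φ (p ++ a :: b :: s) (P ++ k :: l :: L)
      = rA q b a l k • Φ (p ++ b :: a :: s) (P ++ l :: k :: L)
        + rB q b a l k • Φ (p ++ b :: a :: s) (P ++ k :: l :: L)

lemma Exchangeable.perm {q : ℂ} {t t' : List ℂ} {Φ : List ℂ → List (Fin n) → H}
    (h : Exchangeable q t Φ) (htt : t.Perm t') : Exchangeable q t' Φ :=
  fun p a b s hp => h p a b s (hp.trans htt.symm)

lemma Exchangeable.tail {q x : ℂ} {t : List ℂ} {Φ : List ℂ → List (Fin n) → H}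
    (h : Exchangeable q (x :: t) Φ) (k : Fin n) :
    Exchangeable q t fun ts L => Φ (x :: ts) (k :: L) :=
  fun p a b s hp P k' l L hP => h (x :: p) a b s (hp.cons x) (k :: P) k' l L (by simp [hP])

theorem nestedBethe_exchangeable (q : ℂ) {N : ℕ}
    (T : ℂ → Matrix (Fin (N + 2)) (Fin (N + 2)) (Module.End ℂ H)) (lam : Fin (N + 2) → ℂ → ℂ)
    (vac : H) (t : Fin N → List ℂ) (ts : List ℂ) (hts : ts.Nodup)
    (hdisj : ∀ x ∈ (List.ofFn t).flatten, x ∉ ts) :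
    Exchangeable q ts (nestedBethe q T lam vac t) := by
  intro p a b s hp
  have hnd : (p ++ a :: b :: s).Nodup := hp.nodup_iff.2 hts
  have hab : b ≠ a := by
    have := (List.nodup_append.1 hnd).2.1
    rw [List.nodup_cons] at this
    rintro rfl
    simp at this
  have hlen : (p ++ b :: a :: s).length = (p ++ a :: b :: s).length := by simp
  refine betheVector_rel q N (chain q (lower T) (p ++ b :: a :: s))
    (chain q (lower T) (p ++ a :: b :: s)) (fun i => lam i.succ) (fun i => lam i.succ)
    (chainVac _ vac) (chainVac _ vac) t (fun _ => exchangeRel H q (N + 1) p.length a b) ?_ ?_ ?_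
  · intro x F hF i j w hw
    have hx := hdisj x (hF.subset (by simp))
    refine chain_exchangeRel q (lower T) hab ?_ ?_ p s i j w hw
    · rintro rfl
      exact hx (hp.subset (by simp))
    · rintro rfl
      exact hx (hp.subset (by simp))
  · intro k x _
    rfl
  -- The vacuum is compatible: `R(b,a)` multiplies `e_1 ⊗ e_1` by `f(b,a)`, and components with
  -- different indices at the two sites vanish.
  · intro P k l L _
    rw [hlen]
    generalize (p ++ a :: b :: s).length = r
    by_cases hkl : l = k
    · subst hkl
      simp [rA, rB]
    · have : ∀ k l : Fin (N + 1), l ≠ k → chainVac r vac (P ++ k :: l :: L) = 0 := by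
        intro k l hkl
        refine if_neg fun h => hkl ?_
        have h' := (List.eq_replicate_iff.1 h).2
        rw [h' k (by simp), h' l (by simp)]
      simp [this k l hkl, this l k (Ne.symm hkl)]

/-! ### Symmetry of the sums of products of creation operators -/

lemma creationSum_add (T : ℂ → Matrix (Fin (n + 1)) (Fin (n + 1)) (Module.End ℂ H)) (t : List ℂ)
    (Φ Ψ : List (Fin n) → H) :
    creationSum T t (fun L => Φ L + Ψ L) = creationSum T t Φ + creationSum T t Ψ := by
  induction t generalizing Φ Ψ with
  | nil => rfl
  | cons x t ih => simp only [creationSum, ih, map_add, Finset.sum_add_distrib]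

lemma creationSum_smul (T : ℂ → Matrix (Fin (n + 1)) (Fin (n + 1)) (Module.End ℂ H)) (t : List ℂ)
    (c : ℂ) (Φ : List (Fin n) → H) :
    creationSum T t (fun L => c • Φ L) = c • creationSum T t Φ := by
  induction t generalizing Φ with
  | nil => rfl
  | cons x t ih => simp only [creationSum, ih, map_smul, Finset.smul_sum]

theorem creationSum_perm {q : ℂ} {D : Set ℂ}
    {T : ℂ → Matrix (Fin (n + 1)) (Fin (n + 1)) (Module.End ℂ H)} {lam : Fin (n + 1) → ℂ → ℂ}
    {vac : H} (hT : IsModel q D T lam vac) {t t' : List ℂ} (htt : t.Perm t')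
    (hD : ∀ x ∈ t, x ∈ D) (hgen : Generic q t) (Φ : List ℂ → List (Fin n) → H)
    (hΦ : Exchangeable q t Φ) : creationSum T t (Φ t) = creationSum T t' (Φ t') := by
  induction htt generalizing Φ with
  | nil => rfl
  | cons x _ ih =>
    rw [creationSum, creationSum]
    refine Finset.sum_congr rfl fun k _ => congrArg _ ?_
    exact ih (fun y hy => hD y (List.mem_cons_of_mem _ hy))
      ⟨(List.nodup_cons.1 hgen.1).2, fun y hy y' hy' => hgen.2 y (List.mem_cons_of_mem _ hy) y'
        (List.mem_cons_of_mem _ hy')⟩ (fun ts L => Φ (x :: ts) (k :: L)) (hΦ.tail k)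
  | swap a b s =>
    have hab : b ≠ a := by
      have := List.nodup_cons.1 hgen.1
      rintro rfl
      simp at this
    have hf : f q a b ≠ 0 := hgen.2 a (by simp) b (by simp) hab.symm
    have hex := hT.exchange (hD a (by simp)) (hD b (by simp)) hab.symm
    have h₁ : ∀ k l : Fin n, f q a b • creationSum T s (fun L => Φ (b :: a :: s) (k :: l :: L))
        = rA q a b l k • creationSum T s (fun L => Φ (a :: b :: s) (l :: k :: L))
          + rB q a b l k • creationSum T s (fun L => Φ (a :: b :: s) (k :: l :: L)) := by
      intro k l
      simp only [← creationSum_smul, ← creationSum_add]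
      exact congrArg _ (funext fun L => hΦ [] b a s (List.Perm.refl _) [] k l L rfl)
    have h₂ : ∀ (k l : Fin n) (w : H), f q a b • T a 0 k.succ (T b 0 l.succ w)
        = rA q a b k l • T b 0 l.succ (T a 0 k.succ w)
          + rB q a b l k • T b 0 k.succ (T a 0 l.succ w) := by
      intro k l w
      simpa [rA, rB] using hex 0 0 k.succ l.succ w
    -- After multiplication by `f(a,b)`, one side is rewritten by the exchange of operators and the
    -- other by the exchange of components; the results differ only by the names of the summation
    -- indices in the `rA` term.
    refine smul_right_injective H hf ?_
    simp only [creationSum, map_sum, Finset.smul_sum, h₂]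
    simp only [← map_smul, h₁]
    simp only [map_add, map_smul, Finset.sum_add_distrib]
    congr 1
    exact Finset.sum_comm
  | trans h₁ _ ih₁ ih₂ =>
    rw [ih₁ hD hgen Φ hΦ]
    exact ih₂ (fun x hx => hD x (h₁.symm.subset hx))
      ⟨h₁.nodup_iff.1 hgen.1, fun x hx y hy =>
        hgen.2 x (h₁.symm.subset hx) y (h₁.symm.subset hy)⟩ Φ (hΦ.perm h₁)

end

/-! ### Removing one parameter from a product of creation operators -/

section
variable {H : Type u} [AddCommGroup H]

/-- The sum over the elements `y` of `t` of `F y s`, where `s` is the rest of `t`. -/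
def eraseSum (t : List ℂ) (F : ℂ → List ℂ → H) : H :=
  ∑ i : Fin t.length, F (t.get i) (t.eraseIdx i)

lemma eraseSum_nil (F : ℂ → List ℂ → H) : eraseSum [] F = 0 := rfl

lemma eraseSum_cons (a : ℂ) (t : List ℂ) (F : ℂ → List ℂ → H) :
    eraseSum (a :: t) F = F a t + eraseSum t fun y s => F y (a :: s) :=
  Fin.sum_univ_succ (n := t.length) fun i => F ((a :: t).get i) ((a :: t).eraseIdx i)

lemma eraseSum_congr {t : List ℂ} {F G : ℂ → List ℂ → H}
    (h : ∀ y s, (y :: s).Perm t → F y s = G y s) : eraseSum t F = eraseSum t G :=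
  Finset.sum_congr rfl fun i _ => h _ _ (List.getElem_cons_eraseIdx_perm i.2)

lemma eraseSum_add (t : List ℂ) (F G : ℂ → List ℂ → H) :
    eraseSum t (fun y s => F y s + G y s) = eraseSum t F + eraseSum t G :=
  Finset.sum_add_distrib

lemma sum_eraseSum {ι : Type*} (S : Finset ι) (t : List ℂ) (F : ι → ℂ → List ℂ → H) :
    ∑ k ∈ S, eraseSum t (F k) = eraseSum t fun y s => ∑ k ∈ S, F k y s :=
  Finset.sum_comm

variable [Module ℂ H] {n : ℕ}

lemma map_eraseSum {H' : Type*} [AddCommGroup H'] [Module ℂ H'] (φ : H →ₗ[ℂ] H') (t : List ℂ)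
    (F : ℂ → List ℂ → H) : φ (eraseSum t F) = eraseSum t fun y s => φ (F y s) :=
  map_sum φ _ _

lemma smul_eraseSum (c : ℂ) (t : List ℂ) (F : ℂ → List ℂ → H) :
    c • eraseSum t F = eraseSum t fun y s => c • F y s :=
  Finset.smul_sum

lemma fProd_cons_singleton (q a y : ℂ) (s : List ℂ) :
    fProd q (a :: s) [y] = f q a y * fProd q s [y] := by simp [fProd]

lemma g_swap (q u v : ℂ) : g q u v = -g q v u := by
  rw [g, g, ← neg_sub v u, div_neg]

/-- The scalar identity which merges the several ways of removing `y` past `a` into a single term.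
For `l = k` the flip is trivial, so only the sum of the two coefficients has to agree. -/
lemma exchange_coeff (q : ℂ) {a y z : ℂ} (hay : a ≠ y) (haz : a ≠ z) (hyz : y ≠ z)
    (k l : Fin n) (X X' : H) (h : l = k → X' = X) :
    (a * g q a z * (y * g q a y)) • X
        + (y * g q y z) • (rA q a z l k • X' + rB q a z l k • X)
      = (y * g q y z) • (rA q a y l k • X' + rB q a y l k • X) := by
  have h1 := sub_ne_zero.2 hay
  have h2 := sub_ne_zero.2 haz
  have h3 := sub_ne_zero.2 hyz
  rcases lt_trichotomy l k with hlk | hlk | hlk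
  · simp only [rA, rB, hlk, hlk.ne, if_true, if_false, g]
    match_scalars <;> field_simp
    ring
  · rw [h hlk]
    simp only [rA, rB, hlk, lt_self_iff_false, if_true, if_false, g, f]
    generalize q⁻¹ = q'
    match_scalars
    field_simp
    ring
  · simp only [rA, rB, hlk, hlk.ne', not_lt_of_gt, if_true, if_false, g]
    match_scalars <;> field_simp
    ring

variable {q : ℂ} {D : Set ℂ} {T : ℂ → Matrix (Fin (n + 1)) (Fin (n + 1)) (Module.End ℂ H)}
  {lam : Fin (n + 1) → ℂ → ℂ} {vac : H}

lemma IsModel.diag_creation (hT : IsModel q D T lam vac) {u a : ℂ} (hu : u ∈ D) (ha : a ∈ D)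
    (hua : u ≠ a) (k : Fin n) (w : H) :
    T u 0 0 (T a 0 k.succ w) = f q a u • T a 0 k.succ (T u 0 0 w)
      + (a * g q u a) • T u 0 k.succ (T a 0 0 w) := by
  have h := hT.exchange ha hu hua.symm 0 0 k.succ 0 w
  simp only [rA, rB, if_true, lt_self_iff_false, if_false, zero_smul, add_zero, Fin.succ_ne_zero,
    one_smul, Fin.succ_pos] at h
  rw [h, g_swap q u a]
  module

lemma IsModel.creation_creation (hT : IsModel q D T lam vac) {u a : ℂ} (hu : u ∈ D) (ha : a ∈ D)
    (hua : a ≠ u) (k l : Fin n) (w : H) :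
    f q a u • T a 0 k.succ (T u 0 l.succ w) = rA q a u k l • T u 0 l.succ (T a 0 k.succ w)
      + rB q a u l k • T u 0 k.succ (T a 0 l.succ w) := by
  simpa [rA, rB] using hT.exchange ha hu hua 0 0 k.succ l.succ w

lemma Exchangeable.creationSum {t : List ℂ} {Φ : List ℂ → List (Fin n) → H}
    (hΦ : Exchangeable q t Φ) {a b : ℂ} {s : List ℂ} (h : (a :: b :: s).Perm t) (k l : Fin n) :
    f q b a • creationSum T s (fun L => Φ (a :: b :: s) (k :: l :: L))
      = rA q b a l k • UqBethe.creationSum T s (fun L => Φ (b :: a :: s) (l :: k :: L))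
        + rB q b a l k • UqBethe.creationSum T s (fun L => Φ (b :: a :: s) (k :: l :: L)) := by
  simp only [← creationSum_smul, ← creationSum_add]
  exact congrArg _ (funext fun L => hΦ [] a b s h [] k l L rfl)

/-- The action of `T_{1,1}(u)` on a sum of products of creation operators. -/
theorem diag_creationSum (hT : IsModel q D T lam vac) {u : ℂ} (hu : u ∈ D) {t : List ℂ}
    (hut : u ∉ t) (hD : ∀ x ∈ t, x ∈ D) (ht : t.Nodup) (Φ : List ℂ → List (Fin n) → H)
    (hΦ : Exchangeable q t Φ)
    (hs : ∀ t', t'.Perm t → ∀ L, ∀ x ∈ u :: t, T x 0 0 (Φ t' L) = lam 0 x • Φ t' L) :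
    T u 0 0 (creationSum T t (Φ t))
      = (lam 0 u * fProd q t [u]) • creationSum T t (Φ t)
        + eraseSum t fun y s => (lam 0 y * (y * g q u y) * fProd q s [y]) •
            ∑ k : Fin n, T u 0 k.succ (creationSum T s fun L => Φ (y :: s) (k :: L)) := by
  induction t generalizing u Φ with
  | nil => simp [creationSum, eraseSum_nil, fProd, hs [] (List.Perm.refl _) [] u (by simp)]
  | cons a t ih =>
    rw [List.mem_cons, not_or] at hut
    have ha : a ∈ D := hD a (by simp)
    rw [List.nodup_cons] at ht
    have hD' : ∀ x ∈ t, x ∈ D := fun x hx => hD x (List.mem_cons_of_mem _ hx)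
    have ih' : ∀ v ∈ D, v ∉ t → v ∈ u :: a :: t → ∀ k : Fin n, _ := fun v hv hvt hvu k =>
      ih hv hvt hD' ht.2 (fun ts L => Φ (a :: ts) (k :: L)) (hΦ.tail k)
        (fun t' ht' L x hx => hs (a :: t') (ht'.cons a) (k :: L) x (by
          rcases List.mem_cons.1 hx with rfl | hx
          · exact hvu
          · simp [hx]))
    -- The term in which `u` replaces `y` arises in two ways: `T_{1,1}(u)` passes `T(a)` and is
    -- exchanged with `y` later, or it is first exchanged with `a` and then `T_{1,1}(a)` with `y`.
    -- Both are brought to the order `T(u) T(a)` and merged by `exchange_coeff`; the exchange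
    -- relation of `Φ` then moves `y` to the front.
    have key : ∀ y s, (y :: s).Perm t →
        ∑ k : Fin n, (f q a u • T a 0 k.succ ((lam 0 y * (y * g q u y) * fProd q s [y]) •
            ∑ l : Fin n, T u 0 l.succ (creationSum T s fun L => Φ (a :: y :: s) (k :: l :: L)))
          + (a * g q u a) • T u 0 k.succ ((lam 0 y * (y * g q a y) * fProd q s [y]) •
            ∑ l : Fin n, T a 0 l.succ (creationSum T s fun L => Φ (a :: y :: s) (k :: l :: L))))
        = (lam 0 y * (y * g q u y) * fProd q (a :: s) [y]) •
          ∑ k : Fin n, T u 0 k.succ (creationSum T (a :: s) fun L => Φ (y :: a :: s) (k :: L)) := by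
      intro y s hys
      have hyt : y ∈ t := hys.subset (by simp)
      have hay : a ≠ y := fun h => ht.1 (h ▸ hyt)
      have hyu : y ≠ u := fun h => hut.2 (h ▸ hyt)
      set V : Fin n → Fin n → H := fun k l =>
        creationSum T s fun L => Φ (a :: y :: s) (k :: l :: L) with hV
      have hex : ∀ k l : Fin n,
          f q a y • creationSum T s (fun L => Φ (y :: a :: s) (k :: l :: L))
            = rA q a y l k • V l k + rB q a y l k • V k l := fun k l =>
        hΦ.creationSum ((List.Perm.swap a y s).trans (hys.cons a)) k l
      have hl : ∑ k : Fin n, ∑ l : Fin n, f q a u • T a 0 k.succ (T u 0 l.succ (V k l))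
          = ∑ k : Fin n, ∑ l : Fin n, (rA q a u l k • T u 0 k.succ (T a 0 l.succ (V l k))
            + rB q a u l k • T u 0 k.succ (T a 0 l.succ (V k l))) := by
        simp only [hT.creation_creation hu ha (Ne.symm hut.1), Finset.sum_add_distrib]
        congr 1
        exact Finset.sum_comm
      calc _ = (lam 0 y * (y * g q u y) * fProd q s [y]) •
              (∑ k : Fin n, ∑ l : Fin n, f q a u • T a 0 k.succ (T u 0 l.succ (V k l)))
            + (lam 0 y * fProd q s [y]) • ∑ k : Fin n, ∑ l : Fin n,
              (a * g q u a * (y * g q a y)) • T u 0 k.succ (T a 0 l.succ (V k l)) := by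
            simp only [map_smul, map_sum, Finset.smul_sum, Finset.sum_add_distrib]
            congr 1 <;> refine Finset.sum_congr rfl fun k _ => Finset.sum_congr rfl fun l _ => ?_
            · module
            · module
        _ = (lam 0 y * fProd q s [y]) • ∑ k : Fin n, ∑ l : Fin n, (y * g q u y) •
              T u 0 k.succ (T a 0 l.succ (rA q a y l k • V l k + rB q a y l k • V k l)) := by
            rw [hl]
            simp only [Finset.smul_sum, ← Finset.sum_add_distrib]
            refine Finset.sum_congr rfl fun k _ => Finset.sum_congr rfl fun l _ => ?_
            have := exchange_coeff q hay (Ne.symm hut.1) hyu k l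
              (T u 0 k.succ (T a 0 l.succ (V k l))) (T u 0 k.succ (T a 0 l.succ (V l k)))
              (by rintro rfl; rfl)
            rw [g_swap q a u, g_swap q y u] at this
            simp only [map_add, map_smul]
            linear_combination (norm := module) (-(lam 0 y * fProd q s [y])) • this
        _ = _ := by
            simp only [← hex, creationSum, map_sum, map_smul, Finset.smul_sum,
              fProd_cons_singleton]
            refine Finset.sum_congr rfl fun k _ => Finset.sum_congr rfl fun l _ => ?_
            module
    rw [eraseSum_cons, ← eraseSum_congr key, ← sum_eraseSum]
    simp only [eraseSum_add]
    simp only [← smul_eraseSum, ← map_eraseSum]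
    rw [creationSum, map_sum]
    simp only [hT.diag_creation hu ha hut.1]
    have h₁ := ih' u hu hut.2 (by simp)
    have h₂ := ih' a ha ht.1 (by simp)
    simp only [h₁, h₂, map_add, smul_add, Finset.sum_add_distrib, map_smul, fProd_cons_singleton,
      Finset.smul_sum, smul_smul]
    rw [mul_left_comm (f q a u), ← mul_assoc (a * g q u a), mul_comm (a * g q u a) (lam 0 a)]
    abel

/-- The flip part of a creation operator outputs only its own column index, which is at least 2;
along `e_1` the identity part alone acts, with coefficient 1. -/
lemma creationSum_siteExt_zero (z : ℂ) (t : List ℂ) (Φ : List (Fin n) → H) :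
    creationSum (siteExt q T z) t (fun L => Pi.single 0 (Φ L)) 0 = creationSum T t Φ := by
  induction t generalizing Φ with
  | nil => simp [creationSum]
  | cons a t ih =>
    simp only [creationSum, Finset.sum_apply, siteExt_apply, (Fin.succ_ne_zero _).symm, if_false,
      add_zero, rA, Fin.succ_ne_zero, one_smul, ih fun L => Φ (_ :: L)]

/-- The components along `e_2, e_3, …` of the additional tensor factor of a sum of products of
creation operators of the model with monodromy matrix `T(u) R_{0,1}(u,z)`. -/
theorem creationSum_siteExt_succ (hT : IsModel q D T lam vac) {z : ℂ} {t : List ℂ} (hzt : z ∉ t)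
    (hD : ∀ x ∈ t, x ∈ D) (ht : t.Nodup) (Φ : List ℂ → List (Fin n) → H)
    (hΦ : Exchangeable q t Φ)
    (hs : ∀ t', t'.Perm t → ∀ L, ∀ x ∈ t, T x 0 0 (Φ t' L) = lam 0 x • Φ t' L) (k : Fin n) :
    creationSum (siteExt q T z) t (fun L => Pi.single 0 (Φ t L)) k.succ
      = eraseSum t fun y s => (lam 0 y * gl q y z * fProd q s [y]) •
          creationSum T s fun L => Φ (y :: s) (k :: L) := by
  induction t generalizing Φ k with
  | nil => simp [creationSum, eraseSum_nil]
  | cons a t ih =>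
    rw [List.mem_cons, not_or] at hzt
    have ha : a ∈ D := hD a (by simp)
    rw [List.nodup_cons] at ht
    have hD' : ∀ x ∈ t, x ∈ D := fun x hx => hD x (List.mem_cons_of_mem _ hx)
    have ih' : ∀ l k : Fin n, _ := fun l k =>
      ih hzt.2 hD' ht.2 (fun ts L => Φ (a :: ts) (l :: L)) (hΦ.tail l)
        (fun t' ht' L x hx => hs (a :: t') (ht'.cons a) (l :: L) x (List.mem_cons_of_mem _ hx)) k
    have hE := diag_creationSum hT ha ht.1 hD' ht.2 (fun ts L => Φ (a :: ts) (k :: L)) (hΦ.tail k)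
      (fun t' ht' L x hx => hs (a :: t') (ht'.cons a) (k :: L) x hx)
    -- Three contributions for a removed `y` in `t`: the identity and flip parts of the site matrix
    -- at `a`, and the unwanted terms of `T_{1,1}(a)`, which the flip lets act on the `e_1`
    -- component. The wanted term of `T_{1,1}(a)` is the summand in which `a` itself is removed.
    have key : ∀ y s, (y :: s).Perm t →
        (lam 0 y * gl q y z * fProd q (a :: s) [y]) •
            creationSum T (a :: s) (fun L => Φ (y :: a :: s) (k :: L))
          = (∑ l : Fin n, rA q a z l k • T a 0 l.succ ((lam 0 y * gl q y z * fProd q s [y]) •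
              creationSum T s fun L => Φ (a :: y :: s) (l :: k :: L)))
            + (∑ l : Fin n, rB q a z l k • T a 0 l.succ ((lam 0 y * gl q y z * fProd q s [y]) •
              creationSum T s fun L => Φ (a :: y :: s) (k :: l :: L)))
            + (g q a z * a) • (lam 0 y * (y * g q a y) * fProd q s [y]) • ∑ l : Fin n,
              T a 0 l.succ (creationSum T s fun L => Φ (a :: y :: s) (k :: l :: L)) := by
      intro y s hys
      have hyt : y ∈ t := hys.subset (by simp)
      have hay : a ≠ y := fun h => ht.1 (h ▸ hyt)
      have hyz : y ≠ z := fun h => hzt.2 (h ▸ hyt)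
      have hex := fun l => hΦ.creationSum (T := T) ((List.Perm.swap a y s).trans (hys.cons a)) k l
      rw [creationSum, fProd_cons_singleton,
        show lam 0 y * gl q y z * (f q a y * fProd q s [y])
          = (lam 0 y * gl q y z * fProd q s [y]) * f q a y by ring, mul_smul, Finset.smul_sum]
      simp only [← map_smul, hex]
      simp only [map_add, map_smul, Finset.smul_sum, ← Finset.sum_add_distrib]
      refine Finset.sum_congr rfl fun l _ => ?_
      have := exchange_coeff q hay (Ne.symm hzt.1) hyz k l
        (T a 0 l.succ (UqBethe.creationSum T s fun L => Φ (a :: y :: s) (k :: l :: L)))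
        (T a 0 l.succ (UqBethe.creationSum T s fun L => Φ (a :: y :: s) (l :: k :: L)))
        (by rintro rfl; rfl)
      simp only [gl]
      linear_combination (norm := module) (-(lam 0 y * fProd q s [y])) • this
    rw [eraseSum_cons, eraseSum_congr key]
    simp only [eraseSum_add, ← sum_eraseSum]
    simp only [← smul_eraseSum, ← map_eraseSum]
    have hrA : ∀ l : Fin n, rA q a z l.succ k.succ = rA q a z l k := fun l => by simp [rA]
    have hrB : ∀ l : Fin n, rB q a z l.succ k.succ = rB q a z l k := fun l => by simp [rB]
    rw [creationSum, Finset.sum_apply]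
    simp only [siteExt_apply, Fin.succ_inj, Finset.sum_add_distrib, Finset.sum_ite_eq,
      Finset.mem_univ, if_true, Fin.sum_univ_succ, hrA, hrB, ih', smul_eraseSum,
      creationSum_siteExt_zero]
    have hB0 : rB q a z 0 k.succ = g q a z * a := by simp [rB]
    rw [hE, hB0, smul_add, smul_smul, smul_eraseSum,
      show g q a z * a * (lam 0 a * fProd q t [a]) = lam 0 a * gl q a z * fProd q t [a] by
        rw [gl]; ring]
    abel

end

/-! ### Bethe vectors of the extended model, one color at a time -/

lemma colorSet_tail {N : ℕ} (t : Fin (N + 1) → List ℂ) (j : ℕ) :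
    colorSet (fun k : Fin N => t k.succ) j = colorSet t (j + 1) := by
  unfold colorSet
  by_cases h : j < N
  · rw [dif_pos h, dif_pos (by omega)]; rfl
  · rw [dif_neg h, dif_neg (by omega)]

lemma colorSet_zero {N : ℕ} (t : Fin (N + 1) → List ℂ) : colorSet t 0 = t 0 := by
  simp [colorSet]

lemma fProd_perm_left (q : ℂ) {us us' : List ℂ} (h : us.Perm us') (vs : List ℂ) :
    fProd q us vs = fProd q us' vs := (h.map _).prod_eq

lemma fProd_perm_right (q : ℂ) (us : List ℂ) {vs vs' : List ℂ} (h : vs.Perm vs') :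
    fProd q us vs = fProd q us vs' := by
  unfold fProd
  exact congrArg List.prod (List.map_congr_left fun u _ => (h.map _).prod_eq)

lemma fProd_cons_left (q u : ℂ) (us vs : List ℂ) :
    fProd q (u :: us) vs = fProd q [u] vs * fProd q us vs := by simp [fProd]

lemma fProd_cons_right (q v : ℂ) (us vs : List ℂ) :
    fProd q us (v :: vs) = fProd q us [v] * fProd q us vs := by
  simp [fProd, List.prod_map_mul]

lemma mem_flatten_of_mem_colorSet {N : ℕ} {t : Fin N → List ℂ} {k : ℕ} {x : ℂ}
    (hx : x ∈ colorSet t k) : x ∈ (List.ofFn t).flatten := by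
  rw [colorSet] at hx
  split_ifs at hx with h
  · exact List.mem_flatten.2 ⟨_, List.mem_ofFn.2 ⟨⟨k, h⟩, rfl⟩, hx⟩
  · simp at hx

lemma fProd_singleton_ne_zero {q x : ℂ} {s : List ℂ} (h : ∀ v ∈ s, f q x v ≠ 0) :
    fProd q [x] s ≠ 0 := by
  simp only [fProd, List.map_cons, List.map_nil, List.prod_singleton]
  refine List.prod_ne_zero fun h0 => ?_
  obtain ⟨v, hv, h0⟩ := List.mem_map.1 h0
  exact h v hv h0

section
variable {H : Type u} [AddCommGroup H] [Module ℂ H]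

/-- The sum over the partitions of the first `k` sets of parameters into one-element subsets and
their complements. -/
noncomputable def partSum (q : ℂ) : (N : ℕ) → (lam : Fin (N + 1) → ℂ → ℂ) → (z : ℂ) →
    (t : Fin N → List ℂ) → (k : Fin (N + 1)) → (G : (Fin N → List ℂ) → H) → H
  | 0, _, _, t, _, G => G t
  | N + 1, lam, z, t, k, G =>
    Fin.cases (G t) (fun k => eraseSum (t 0) fun y s =>
      (alpha lam 0 y * gl q y z * fProd q s [y] / fProd q (colorSet t 1) [y]) •
        partSum q N (fun i => lam i.succ) y (fun i => t i.succ) k fun t' => G (Fin.cons s t')) k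

lemma partSum_zero (q : ℂ) (N : ℕ) (lam : Fin (N + 1) → ℂ → ℂ) (z : ℂ) (t : Fin N → List ℂ)
    (G : (Fin N → List ℂ) → H) : partSum q N lam z t 0 G = G t := by
  cases N <;> rfl

lemma partSum_succ (q : ℂ) (N : ℕ) (lam : Fin (N + 2) → ℂ → ℂ) (z : ℂ) (t : Fin (N + 1) → List ℂ)
    (k : Fin (N + 1)) (G : (Fin (N + 1) → List ℂ) → H) :
    partSum q (N + 1) lam z t k.succ G = eraseSum (t 0) fun y s =>
      (alpha lam 0 y * gl q y z * fProd q s [y] / fProd q (colorSet t 1) [y]) •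
        partSum q N (fun i => lam i.succ) y (fun i => t i.succ) k fun t' => G (Fin.cons s t') :=
  rfl

lemma map_partSum {H' : Type u} [AddCommGroup H'] [Module ℂ H'] (φ : H →ₗ[ℂ] H') (q : ℂ) (N : ℕ)
    (lam : Fin (N + 1) → ℂ → ℂ) (z : ℂ) (t : Fin N → List ℂ) (k : Fin (N + 1))
    (G : (Fin N → List ℂ) → H) :
    φ (partSum q N lam z t k G) = partSum q N lam z t k fun t' => φ (G t') := by
  induction N generalizing z with
  | zero => rfl
  | succ N ih =>
    refine Fin.cases ?_ (fun k => ?_) k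
    · simp only [partSum_zero]
    · simp only [partSum_succ, map_eraseSum, map_smul, ih]

lemma smul_partSum (c : ℂ) (q : ℂ) (N : ℕ) (lam : Fin (N + 1) → ℂ → ℂ) (z : ℂ)
    (t : Fin N → List ℂ) (k : Fin (N + 1)) (G : (Fin N → List ℂ) → H) :
    c • partSum q N lam z t k G = partSum q N lam z t k fun t' => c • G t' :=
  map_partSum (c • LinearMap.id) q N lam z t k G

/-- Nesting multiplies the first `α` by `f(y, s)`. This is exactly the factor lost from the
normalization `f(t̄, s)` when `y` is removed from the first set. -/
lemma partSum_chainLam (q : ℂ) (N : ℕ) (lam : Fin (N + 1) → ℂ → ℂ) (s : List ℂ) (z : ℂ)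
    (t : Fin N → List ℂ) (k : Fin (N + 1)) (G : (Fin N → List ℂ) → H)
    (hs : ∀ x ∈ colorSet t 0, fProd q [x] s ≠ 0) :
    (fProd q (colorSet t 0) s)⁻¹ • partSum q N (chainLam q lam s) z t k G
      = partSum q N lam z t k fun t' => (fProd q (colorSet t' 0) s)⁻¹ • G t' := by
  cases N with
  | zero => rfl
  | succ N =>
    refine Fin.cases ?_ (fun k => ?_) k
    · simp only [partSum_zero]
    · simp only [partSum_succ, smul_eraseSum]
      refine eraseSum_congr fun y s' h => ?_
      simp only [colorSet_zero, Fin.cons_zero]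
      rw [← smul_partSum, ← fProd_perm_left q h, fProd_cons_left, smul_smul, smul_smul]
      have hy : fProd q [y] s ≠ 0 := hs y (by rw [colorSet_zero]; exact h.subset (by simp))
      have ha : alpha (chainLam q lam s) 0 y = alpha lam 0 y * fProd q [y] s := by
        simp only [alpha, chainLam, Fin.castSucc_zero, Fin.cons_zero, Fin.cons_succ]
        ring
      rw [ha]
      congr 1
      rw [mul_inv]
      field_simp

/-- `creationSum` as a linear map. -/
noncomputable def creationSumₗ {n : ℕ}
    (T : ℂ → Matrix (Fin (n + 1)) (Fin (n + 1)) (Module.End ℂ H)) (t : List ℂ) :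
    (List (Fin n) → H) →ₗ[ℂ] H where
  toFun := creationSum T t
  map_add' := creationSum_add T t
  map_smul' := creationSum_smul T t

lemma IsModel.lowerBlock {n : ℕ} {q : ℂ} {D : Set ℂ}
    {T : ℂ → Matrix (Fin (n + 1)) (Fin (n + 1)) (Module.End ℂ H)} {lam : Fin (n + 1) → ℂ → ℂ}
    {vac : H} (hT : IsModel q D T lam vac) :
    IsModel q D (UqBethe.lower T) (fun i => lam i.succ) vac where
  rtt u hu v hv huv := (rtt_iff_exchange _ _ _ _ _).2 fun a a' b b' w => by
    simpa [rA, rB, UqBethe.lower] using hT.exchange hu hv huv a.succ a'.succ b.succ b'.succ w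
  diag u hu i := hT.diag u hu i.succ
  lower u hu i j hij := hT.lower u hu i.succ j.succ (Fin.succ_lt_succ_iff.2 hij)

lemma betheVector_congr_lam (q : ℂ) (N : ℕ)
    (T : ℂ → Matrix (Fin (N + 1)) (Fin (N + 1)) (Module.End ℂ H))
    {lam lam' : Fin (N + 1) → ℂ → ℂ} (h : ∀ i : Fin N, lam i.succ = lam' i.succ) (vac : H)
    (t : Fin N → List ℂ) : betheVector q N T lam vac t = betheVector q N T lam' vac t := by
  let S : Submodule ℂ (H × H) :=
    { carrier := {w | w.1 = w.2}
      zero_mem' := rfl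
      add_mem' := fun h h' => congrArg₂ (· + ·) h h'
      smul_mem' := fun c _ h => congrArg (c • ·) h }
  exact (betheVector_rel q N T T lam lam' vac vac t (fun _ => S)
    (fun x F _ a b w hw => congrArg (T x a b) hw) (fun k x _ => by rw [h]) rfl : _ ∈ S)

/-- The chain over `y :: s` is the chain over `s` with one extra site, so fixing the first index
gives a component of a Bethe vector of an extended model of lower rank. This makes the induction on
the rank possible. -/
lemma nestedBethe_cons (q : ℂ) {N : ℕ}
    (T : ℂ → Matrix (Fin (N + 2)) (Fin (N + 2)) (Module.End ℂ H)) (lam : Fin (N + 2) → ℂ → ℂ)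
    (vac : H) (t : Fin N → List ℂ) (y : ℂ) (s : List ℂ) (k : Fin (N + 1))
    (L : List (Fin (N + 1))) :
    nestedBethe q T lam vac t (y :: s) (k :: L)
      = betheVector q N (siteExt q (chain q (lower T) s) y) (chainLam q (fun i => lam i.succ) s)
          (Pi.single 0 (chainVac s.length vac)) t k L := by
  let S : Submodule ℂ
      ((List (Fin (N + 1)) → H) × (Fin (N + 1) → List (Fin (N + 1)) → H)) :=
    { carrier := {w | slice w.1 = w.2}
      zero_mem' := rfl
      add_mem' := fun h h' => congrArg₂ (· + ·) h h'
      smul_mem' := fun c _ h => congrArg (c • ·) h }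
  refine congrFun (congrFun (betheVector_rel q N (chain q (lower T) (y :: s))
    (siteExt q (chain q (lower T) s) y) (fun i => lam i.succ)
    (chainLam q (fun i => lam i.succ) s) (chainVac _ vac) (Pi.single 0 (chainVac s.length vac)) t
    (fun _ => S) ?_ ?_ ?_ : _ ∈ S) k) L
  · intro x F _ a b w hw
    change slice (chain q (lower T) (y :: s) x a b w.1) = _
    rw [slice_chain_cons, show slice w.1 = w.2 from hw]
  · intro k x _
    rfl
  · exact slice_chainVac s.length vac

/-- Lifts the expansion `h` for the extended nested model to the original rank: the creation sum
over `s`, with its normalization, turns each nested vector into a Bethe vector with first set `s`.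
It serves both the induction on the rank and the final recursion. -/
lemma creationSum_nestedBethe_cons (q : ℂ) {N : ℕ}
    (T : ℂ → Matrix (Fin (N + 2)) (Fin (N + 2)) (Module.End ℂ H)) (lam : Fin (N + 2) → ℂ → ℂ)
    (vac : H) (t : Fin N → List ℂ) (y : ℂ) (s : List ℂ) (k : Fin (N + 1))
    (hs : ∀ x ∈ colorSet t 0, fProd q [x] s ≠ 0)
    (h : betheVector q N (siteExt q (chain q (lower T) s) y)
        (chainLam q (fun i => lam i.succ) s) (Pi.single 0 (chainVac s.length vac)) t k
      = partSum q N (chainLam q (fun i => lam i.succ) s) y t k fun t' =>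
          betheVector q N (chain q (lower T) s) (chainLam q (fun i => lam i.succ) s)
            (chainVac s.length vac) t') :
    ((s.map (lam 1)).prod * fProd q (colorSet t 0) s)⁻¹ •
        creationSum T s (fun L => nestedBethe q T lam vac t (y :: s) (k :: L))
      = partSum q N (fun i => lam i.succ) y t k fun t' =>
          betheVector q (N + 1) T lam vac (Fin.cons s t') := by
  have e : (fun L => nestedBethe q T lam vac t (y :: s) (k :: L))
      = partSum q N (chainLam q (fun i => lam i.succ) s) y t k fun t' =>
          nestedBethe q T lam vac t' s := by
    have hc : (fun t' => betheVector q N (chain q (lower T) s)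
        (chainLam q (fun i => lam i.succ) s) (chainVac s.length vac) t')
        = fun t' => nestedBethe q T lam vac t' s :=
      funext fun t' => betheVector_congr_lam q N _
        (lam := chainLam q (fun i => lam i.succ) s) (lam' := fun i => lam i.succ)
        (fun i => rfl) _ t'
    ext L
    rw [nestedBethe_cons, h, hc]
  have hl := map_partSum (creationSumₗ T s) q N (chainLam q (fun i => lam i.succ) s) y t k fun t' =>
    nestedBethe q T lam vac t' s
  change creationSum T s _ = _ at hl
  rw [e, hl, mul_inv, mul_smul, partSum_chainLam q N _ s y t k _ hs, smul_partSum]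
  congr 1
  ext t' : 1
  rw [betheVector_succ, Fin.cons_zero, mul_inv, mul_smul, ← colorSet_tail]
  rfl

/-- The Bethe vectors of the model with monodromy matrix `T(u) R_{0,1}(u,z)`. -/
theorem betheVector_siteExt {q : ℂ} {D : Set ℂ} {N : ℕ}
    {T : ℂ → Matrix (Fin (N + 1)) (Fin (N + 1)) (Module.End ℂ H)} {lam : Fin (N + 1) → ℂ → ℂ}
    {vac : H} (hT : IsModel q D T lam vac) (z : ℂ) (t : Fin N → List ℂ)
    (hD : ∀ x ∈ (List.ofFn t).flatten, x ∈ D)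
    (hgen : Generic q (List.ofFn t).flatten) (hz : z ∉ (List.ofFn t).flatten)
    (k : Fin (N + 1)) :
    betheVector q N (siteExt q T z) lam (Pi.single 0 vac) t k
      = partSum q N lam z t k fun t' => betheVector q N T lam vac t' := by
  induction N generalizing H D z with
  | zero =>
    obtain rfl : k = 0 := by omega
    simp [betheVector, partSum]
  | succ N ih =>
    rw [List.ofFn_succ, List.flatten_cons] at hD hgen hz
    simp only [List.mem_append, not_or] at hD hz
    have hnd := List.nodup_append.1 hgen.1
    have hD' : ∀ x ∈ (List.ofFn fun i : Fin N => t i.succ).flatten, x ∈ D :=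
      fun x hx => hD x (Or.inr hx)
    have hsing := nestedBethe_siteExt hT z lam (fun _ => rfl) (fun i : Fin N => t i.succ) hD'
      hnd.2.1
    have hdisj : ∀ x ∈ t 0, x ∉ (List.ofFn fun i : Fin N => t i.succ).flatten :=
      fun x hx hx' => hnd.2.2 x hx x hx' rfl
    rw [betheVector_succ]
    have e : nestedBethe q (siteExt q T z) lam (Pi.single 0 vac) (fun i : Fin N => t i.succ) (t 0)
        = fun L => Pi.single 0 (nestedBethe q T lam vac (fun i : Fin N => t i.succ) (t 0) L) :=
      funext fun L => (hsing (t 0) L).1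
    rw [e, Pi.smul_apply]
    refine Fin.cases ?_ (fun k => ?_) k
    · rw [creationSum_siteExt_zero, partSum_zero, betheVector_succ]
    · rw [creationSum_siteExt_succ hT hz.1 (fun x hx => hD x (Or.inl hx)) hnd.1 _
        (nestedBethe_exchangeable q T lam vac _ (t 0) hnd.1 fun x hx hx' => hdisj x hx' hx)
        (fun t' _ L x hx => ((hsing t' L).2 x (hD x (Or.inl hx)) (hdisj x hx)).1) k,
        partSum_succ, smul_eraseSum]
      refine eraseSum_congr fun y s hys => ?_
      have hy : y ∈ t 0 := hys.subset (by simp)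
      have hst : ∀ x ∈ s, x ∈ t 0 := fun x hx => hys.subset (by simp [hx])
      rw [← creationSum_nestedBethe_cons q T lam vac _ y s k]
      -- The normalization for `y :: s` exceeds that for `s` by `λ_2(y) f(t̄², y)`, which converts
      -- `λ_1(y)` into `α_1(y) / f(t̄², y)`.
      · rw [colorSet_tail, smul_smul, smul_smul, ← (hys.map (lam 1)).prod_eq,
          ← fProd_perm_right q _ hys, fProd_cons_right, List.map_cons, List.prod_cons]
        congr 1
        simp only [alpha, mul_inv, div_eq_mul_inv]
        simp only [Fin.castSucc_zero, Fin.succ_zero_eq_one]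
        ring
      · intro x hx
        have hx' := mem_flatten_of_mem_colorSet hx
        exact fProd_singleton_ne_zero fun v hv => hgen.2 x (by simp [hx']) v (by simp [hst v hv])
          fun h => hdisj v (hst v hv) (h ▸ hx')
      -- The induction hypothesis is applied to the nested chain over `s`, on a larger space and
      -- with `s` removed from the domain, with `y` in place of `z`.
      · refine ih (hT.lowerBlock.chain s) y _ (fun x hx => ⟨hD' x hx, fun hx' =>
          hdisj x (hst x hx') hx⟩) ⟨hnd.2.1, fun x hx x' hx' => hgen.2 x (by simp [hx]) x'
            (by simp [hx'])⟩ (hdisj y hy) k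

end

/-! ### Explicit partitions and the recursion -/

section
variable {H : Type u} [AddCommGroup H] [Module ℂ H]

lemma partI_cons {n : ℕ} (z : ℂ) (t : Fin (n + 2) → List ℂ) (j : Fin (n + 1))
    (i : Fin (t 1).length) (p : Partition (fun k => t k.succ) j) (μ : Fin (j.val + 1)) :
    partI z t j.succ (Fin.cons (α := fun ν : Fin (j.val + 1) => Fin (t (color j.succ ν)).length) i p)
      μ.succ = partI ((t 1).get i) (fun k => t k.succ) j p μ := by
  refine Fin.cases ?_ (fun μ => ?_) μ <;> rfl

lemma partII_cons {n : ℕ} (t : Fin (n + 2) → List ℂ) (j : Fin (n + 1))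
    (i : Fin (t 1).length) (p : Partition (fun k => t k.succ) j) :
    partII t j.succ (Fin.cons (α := fun ν : Fin (j.val + 1) => Fin (t (color j.succ ν)).length) i p)
      = Fin.cons (t 0) (Fin.cons ((t 1).eraseIdx i)
          fun k => partII (fun k => t k.succ) j p k.succ) := by
  ext k : 1
  refine Fin.cases ?_ (fun k => Fin.cases ?_ (fun k => ?_) k) k
  · simp [partII]
  · rw [partII, dif_pos (by simp)]
    rfl
  · simp only [Fin.cons_succ]
    by_cases h : k.val + 1 ≤ j.val
    · rw [partII, partII, dif_pos (by simp; omega), dif_pos (by simp; omega)]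
      rfl
    · rw [partII, partII, dif_neg (by simp; omega), dif_neg (by simp; omega)]

/-- The factors of the first chosen element and the denominator of `z` split off; in the rest, the
chosen element plays the role of `z` for the shifted colors. -/
lemma recCoeff_cons {n : ℕ} (q : ℂ) (lam : Fin (n + 3) → ℂ → ℂ) (z : ℂ)
    (t : Fin (n + 2) → List ℂ) (j : Fin (n + 1))
    (i : Fin (t 1).length) (p : Partition (fun k => t k.succ) j) :
    recCoeff q lam z t j.succ
        (Fin.cons (α := fun ν : Fin (j.val + 1) => Fin (t (color j.succ ν)).length) i p)
      = (fProd q (colorSet t 1) [z])⁻¹ * (alpha lam 1 ((t 1).get i) * gl q ((t 1).get i) z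
          * fProd q ((t 1).eraseIdx i) [(t 1).get i])
        * recCoeff q (fun k => lam k.succ) ((t 1).get i) (fun k => t k.succ) j p := by
  set P : Partition t j.succ :=
    Fin.cons (α := fun ν : Fin (j.val + 1) => Fin (t (color j.succ ν)).length) i p with hP
  -- Restated with `j.val + 1` in place of `j.succ.val`, so that the products can be split.
  have e : recCoeff q lam z t j.succ P = (∏ ν : Fin (j.val + 1),
      alpha lam (color j.succ ν) (partI z t j.succ P ν.succ)
        * gl q (partI z t j.succ P ν.succ) (partI z t j.succ P ν.castSucc)
        * fProd q (partII t j.succ P (color j.succ ν)) [partI z t j.succ P ν.succ])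
    / ∏ ν : Fin (j.val + 2), fProd q (colorSet t (ν.val + 1)) [partI z t j.succ P ν] := rfl
  have hI : ∀ μ, partI z t j.succ P μ.succ = partI ((t 1).get i) (fun k => t k.succ) j p μ :=
    partI_cons z t j i p
  have hII : ∀ ν : Fin j.val, partII t j.succ P (color j.succ ν.succ)
      = partII (fun k => t k.succ) j p (color j ν) := fun ν =>
    congrFun (partII_cons t j i p) (color j ν).succ
  have hII0 : partII t j.succ P 1 = (t 1).eraseIdx i :=
    congrFun (partII_cons t j i p) 1
  rw [e, Fin.prod_univ_succ, Fin.prod_univ_succ, recCoeff]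
  simp only [hI, hII, ← Fin.succ_castSucc, Fin.val_succ, colorSet_tail]
  have h5 : ∀ ν : Fin j.val, alpha lam (color j.succ ν.succ)
    = alpha (fun k => lam k.succ) (color j ν) := fun ν => rfl
  have h6 : fProd q (partII t j.succ P (color j.succ (Fin.mk 0 (Nat.succ_pos _)))) [(t 1).get i]
    = fProd q ((t 1).eraseIdx i) [(t 1).get i] := congrArg (fProd q · _) hII0
  simp only [h5]
  refine (congrArg₂ (· / ·) (congrArg₂ (· * ·) (congrArg₂ (· * ·) (congrArg₂ (· * ·)
    (x' := alpha lam 1 ((t 1).get i)) (y' := gl q ((t 1).get i) z) rfl rfl) h6) rfl)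
    (congrArg₂ (· * ·) (x' := fProd q (colorSet t 1) [z]) rfl rfl)).trans ?_
  ring

lemma sum_partition_zero (q : ℂ) (n : ℕ) (lam : Fin (n + 2) → ℂ → ℂ) (z : ℂ)
    (t : Fin (n + 1) → List ℂ) (G : (Fin (n + 1) → List ℂ) → H) :
    ∑ p : Partition t 0, recCoeff q lam z t 0 p • G (partII t 0 p)
      = (fProd q (colorSet t 1) [z])⁻¹ • G t := by
  refine (Fintype.sum_eq_single (α := Partition t 0) (fun ν : Fin 0 => ν.elim0)
    fun p hp => (hp (funext fun ν : Fin 0 => ν.elim0)).elim).trans ?_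
  have hII : ∀ p, partII t 0 p = t := fun p => funext fun k => dif_neg fun h => by
    have := h.1.trans h.2
    simp at this
  refine congrArg₂ (· • ·) ?_ (congrArg G (hII _))
  refine (congrArg₂ (· / ·) (Finset.prod_eq_one fun (ν : Fin 0) _ => ν.elim0)
    (Fin.prod_univ_one fun ν : Fin 1 => fProd q (colorSet t (ν.val + 1)) [partI z t 0 _ ν])).trans ?_
  exact one_div _

/-- The sum over the partitions, computed one color at a time. -/
lemma sum_partition (q : ℂ) (n : ℕ) (lam : Fin (n + 2) → ℂ → ℂ) (z : ℂ)
    (t : Fin (n + 1) → List ℂ) (j : Fin (n + 1)) (G : (Fin (n + 1) → List ℂ) → H) :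
    ∑ p : Partition t j, recCoeff q lam z t j p • G (partII t j p)
      = (fProd q (colorSet t 1) [z])⁻¹ •
        partSum q n (fun i => lam i.succ) z (fun i => t i.succ) j
          fun t' => G (Fin.cons (t 0) t') := by
  induction n generalizing z with
  | zero =>
    obtain rfl : j = 0 := by omega
    rw [sum_partition_zero, partSum_zero]
    exact congrArg (fun t => _ • G t) (Fin.cons_self_tail t).symm
  | succ n ih =>
    induction j using Fin.cases with
    | zero =>
      rw [sum_partition_zero, partSum_zero]
      exact congrArg (fun t => _ • G t) (Fin.cons_self_tail t).symm
    | succ j =>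
      rw [partSum_succ, eraseSum, Finset.smul_sum]
      refine ((Fin.consEquiv fun ν : Fin (j.val + 1) =>
        Fin (t (color j.succ ν)).length).sum_comp (fun p : Partition t j.succ =>
          recCoeff q lam z t j.succ p • G (partII t j.succ p))).symm.trans ?_
      rw [Fintype.sum_prod_type]
      refine Finset.sum_congr rfl fun (i : Fin (t 1).length) _ => ?_
      -- For the shifted colors the set `t 1` comes first and is left whole, whereas here it has
      -- already lost its chosen element; hence the first entry of `t'` is discarded in favor of the
      -- erased list.
      have h := ih (fun k => lam k.succ) ((t 1).get i) (fun k => t k.succ) j fun t' =>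
        G (Fin.cons (t 0) (Fin.cons ((t 1).eraseIdx i) fun k => t' k.succ))
      calc _ = ∑ p : Partition (fun k => t k.succ) j,
            ((fProd q (colorSet t 1) [z])⁻¹ * (alpha lam 1 ((t 1).get i) * gl q ((t 1).get i) z
              * fProd q ((t 1).eraseIdx i) [(t 1).get i])) •
            recCoeff q (fun k => lam k.succ) ((t 1).get i) (fun k => t k.succ) j p •
            G (Fin.cons (t 0) (Fin.cons ((t 1).eraseIdx i)
              fun k => partII (fun k => t k.succ) j p k.succ)) := by
            refine Finset.sum_congr rfl fun p _ => ?_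
            exact (congrArg₂ (fun c t' => c • G t') (recCoeff_cons q lam z t j i p)
              (partII_cons t j i p)).trans (mul_smul _ _ _)
        _ = _ := by
            rw [← Finset.smul_sum, h, smul_smul, smul_smul, mul_assoc, ← div_eq_mul_inv]
            rfl

/-- The recursion for the Bethe vectors on the first set of parameters. -/
theorem betheVector_recursion (q : ℂ)
    (n : ℕ) (D : Set ℂ) (T : ℂ → Matrix (Fin (n + 2)) (Fin (n + 2)) (Module.End ℂ H))
    (lam : Fin (n + 2) → ℂ → ℂ) (vac : H) (hT : IsModel q D T lam vac)
    (z : ℂ) (t : Fin (n + 1) → List ℂ)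
    (hD : ∀ x ∈ z :: (List.ofFn t).flatten, x ∈ D)
    (hgen : Generic q (z :: (List.ofFn t).flatten))
    (s : List ℂ) (hs : s.Perm (z :: t 0)) :
    betheVector q (n + 1) T lam vac (Function.update t 0 s)
      = ∑ j : Fin (n + 1), ∑ p : Partition t j,
          recCoeff q lam z t j p •
            (lam 1 z)⁻¹ • T z 0 j.succ
              (betheVector q (n + 1) T lam vac (partII t j p)) := by
  rw [List.ofFn_succ, List.flatten_cons] at hD hgen
  have hnd := List.nodup_append.1 (List.nodup_cons.1 hgen.1).2
  have hz' := (List.nodup_cons.1 hgen.1).1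
  rw [List.mem_append, not_or] at hz'
  have hdisj : ∀ x ∈ t 0, x ∉ (List.ofFn fun i : Fin n => t i.succ).flatten :=
    fun x hx hx' => hnd.2.2 x hx x hx' rfl
  have hsub : ∀ x ∈ z :: t 0,
      x ∈ z :: (t 0 ++ (List.ofFn fun i : Fin n => t i.succ).flatten) := by
    intro x hx
    rcases List.mem_cons.1 hx with rfl | hx <;> simp [*]
  have htail : (fun k : Fin n => Function.update t 0 s k.succ) = fun k => t k.succ :=
    funext fun k => Function.update_of_ne (Fin.succ_ne_zero k) _ _
  have hgen0 : Generic q (z :: t 0) :=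
    ⟨List.nodup_cons.2 ⟨hz'.1, hnd.1⟩, fun x hx y hy => hgen.2 x (hsub x hx) y (hsub y hy)⟩
  have hex := nestedBethe_exchangeable q T lam vac (fun i : Fin n => t i.succ) (z :: t 0) hgen0.1
    fun x hx hx' => by
      rcases List.mem_cons.1 hx' with rfl | hx'
      · exact hz'.2 hx
      · exact hdisj x hx' hx
  -- The summand with `T_{1,j}(z)` on the right is, up to normalization, the part of the ansatz for
  -- the ordering `z :: t 0` with first tensor index `j`.
  have hmain : ∀ j : Fin (n + 1), ∑ p : Partition t j, recCoeff q lam z t j p •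
      (lam 1 z)⁻¹ • T z 0 j.succ (betheVector q (n + 1) T lam vac (partII t j p))
      = ((lam 1 z)⁻¹ * (fProd q (colorSet t 1) [z])⁻¹
          * (((t 0).map (lam 1)).prod * fProd q (colorSet t 1) (t 0))⁻¹) • T z 0 j.succ
        (creationSum T (t 0) fun L =>
          nestedBethe q T lam vac (fun i : Fin n => t i.succ) (z :: t 0) (j :: L)) := by
    intro j
    rw [sum_partition q n lam z t j fun t' =>
      (lam 1 z)⁻¹ • T z 0 j.succ (betheVector q (n + 1) T lam vac t')]
    have h := creationSum_nestedBethe_cons q T lam vac (fun i : Fin n => t i.succ) z (t 0) j ?_ ?_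
    · rw [colorSet_tail, zero_add] at h
      have hm := map_partSum ((lam 1 z)⁻¹ • T z 0 j.succ : H →ₗ[ℂ] H) q n (fun i => lam i.succ) z
        (fun i => t i.succ) j fun t' => betheVector q (n + 1) T lam vac (Fin.cons (t 0) t')
      simp only [LinearMap.smul_apply] at hm
      rw [mul_smul, ← map_smul, h, ← hm, smul_smul, mul_comm]
    · intro x hx
      have hx' := mem_flatten_of_mem_colorSet hx
      exact fProd_singleton_ne_zero fun v hv => hgen.2 x (by simp [hx']) v (by simp [hv])
        fun h => hdisj v hv (h ▸ hx')
    · refine betheVector_siteExt (hT.lowerBlock.chain (t 0)) z _ (fun x hx => ⟨hD x (by simp [hx]),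
        fun hx' => hdisj x hx' hx⟩) ⟨hnd.2.1, fun x hx y hy => hgen.2 x (by simp [hx]) y
          (by simp [hy])⟩ hz'.2 j
  have hD0 : ∀ x ∈ s, x ∈ D := fun x hx => hD x (hsub x (hs.mem_iff.1 hx))
  have hgens : Generic q s := ⟨hs.nodup_iff.2 hgen0.1, fun x hx y hy =>
    hgen0.2 x (hs.mem_iff.1 hx) y (hs.mem_iff.1 hy)⟩
  -- The creation sum is reordered from `s` to `z :: t 0`; the normalization is symmetric, and its
  -- factor belonging to `z` splits off.
  rw [betheVector_succ, htail, Function.update_self, ← colorSet_tail, htail, colorSet_tail,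
    creationSum_perm hT hs hD0 hgens _ (hex.perm hs.symm), (hs.map (lam 1)).prod_eq,
    fProd_perm_right q _ hs, fProd_cons_right, creationSum, Finset.smul_sum, List.map_cons,
    List.prod_cons]
  refine Finset.sum_congr rfl fun j _ => ?_
  rw [hmain]
  congr 1
  simp only [mul_inv]
  ring

end
end UqBethe

theorem mainTheorem4 {H : Type*} [AddCommGroup H] [Module ℂ H] (q : ℂ) (hq : q ≠ 0)
    (n : ℕ) (D : Set ℂ) (T : ℂ → Matrix (Fin (n + 2)) (Fin (n + 2)) (Module.End ℂ H))
    (lam : Fin (n + 2) → ℂ → ℂ) (vac : H) (hT : UqBethe.IsModel q D T lam vac)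
    (z : ℂ) (t : Fin (n + 1) → List ℂ)
    (hD : ∀ x ∈ z :: (List.ofFn t).flatten, x ∈ D)
    (hgen : UqBethe.Generic q (z :: (List.ofFn t).flatten))
    (hz : lam 1 z ≠ 0) (hlam : ∀ k : Fin (n + 1), ∀ x ∈ t k, lam k.succ x ≠ 0)
    (s : List ℂ) (hs : s.Perm (z :: t 0)) :
    UqBethe.betheVector q (n + 1) T lam vac (Function.update t 0 s)
      = ∑ j : Fin (n + 1), ∑ p : UqBethe.Partition t j,
          UqBethe.recCoeff q lam z t j p •
            (lam 1 z)⁻¹ • T z 0 j.succ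
              (UqBethe.betheVector q (n + 1) T lam vac (UqBethe.partII t j p)) :=
  UqBethe.betheVector_recursion q n D T lam vac hT z t hD hgen s hs
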